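/- Let $P(\lambda)=\sum_{j=0}^m P_j\lambda^j$ be an $n\times n$ complex matrix polynomial with $\det P_m\neq 0$, and let $w(x)=\sum_{j=0}^m w_jx^j$ be a real polynomial with $w_0>0$ and $w_j\ge 0$ for all $j$. With $\|\cdot\|$ the spectral norm, put, for $\varepsilon\ge 0$, $$\mathcal B(P,\varepsilon,w)=\Big\{\textstyle\sum_j (P_j+\Delta_j)\lambda^j:\ \|\Delta_j\|\le\varepsilon w_j,\ 0\le j\le m\Big\},\qquad \Lambda_\varepsilon(P)=\{z\in\mathbb C:\ \det Q(z)=0\text{ for some }Q\in\mathcal B(P,\varepsilon,w)\},$$ and let $\partial\mathcal B(P,\varepsilon,w)$ be the set of those $Q\in\mathcal B(P,\varepsilon,w)$ for which $\|\Delta_j\|=\varepsilon w_j$ for at least one $j$ with $w_j>0$. The algebraic multiplicity of an eigenvalue $\mu$ of a matrix polynomial $Q$ is its multiplicity as a zero of $\det Q(\lambda)$, and its geometric multiplicity is $\dim\ker Q(\mu)$; $\mu$ is multiple if its algebraic multiplicity is at least $2$, and a multiple eigenvalue is defective if its algebraic multiplicity exceeds its geometric multiplicity. Let $s_1(\mu)\ge\dots\ge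 s_n(\mu)$ be the singular values of $P(\mu)$. Given orthonormal bases $u_1,\dots,u_n$ and $v_1,\dots,v_n$ of $\mathbb C^n$ with $P(\mu)v_j=s_j(\mu)u_j$ for all $j$, put $\hat Z=\sum_{j=1}^n u_jv_j^*$ and $\tilde Z=\sum_{j:\,s_j(\mu)=s_n(\mu)}u_jv_j^*$, and let $\hat Q$ and $\tilde Q$ be the matrix polynomials with coefficients $$P_j-\Big(\frac{\overline\mu}{|\mu|}\Big)^j\frac{w_j}{w(|\mu|)}\,s_n(\mu)\,Z,\qquad 0\le j\le m,$$ for $Z=\hat Z$ and $Z=\tilde Z$ respectively (for $\mu=0$ the quotient $\overline\mu/|\mu|$ is read as $0$, with $0^0=1$). Let $\varepsilon>0$ be such that $\Lambda_\varepsilon(P)\ne\mathbb C$, and suppose that, as the parameter increases to $\varepsilon$, two different connected components $\mathcal G_1,\mathcal G_2$ of the pseudospectrum meet at $\mu\in\mathbb C$. That is, for some $0\le\delta_0<\varepsilon$ there are, for every $\delta\in(\delta_0,\varepsilon)$, connected components $\mathcal G_1(\delta)\neq\mathcal G_2(\delta)$ of $\Lambda_\delta(P)$, increasing with $\delta$,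 and $\mu\in\mathcal G_1\cap\mathcal G_2$, where $\mathcal G_i$ is the closure of $\bigcup_{\delta_0<\delta<\varepsilon}\mathcal G_i(\delta)$. Then the following hold. (i) If $\mu\ne0$, then, for every choice of the singular vectors, $\hat Q$ and $\tilde Q$ lie in $\partial\mathcal B(P,\varepsilon,w)$ and $\mu$ is a multiple eigenvalue of both. (ii) If $\mu=0$ and $w$ is constant ($w(x)=w_0$), then, for every choice of the singular vectors, $\hat Q$ and $\tilde Q$ lie in $\partial\mathcal B(P,\varepsilon,w)$ and $0$ is a multiple eigenvalue of both. (iii) If $\mu=0$, $w$ is not constant, $\Lambda_\varepsilon(P)$ is bounded and $\mathcal G_1\cap\mathcal G_2=\{0\}$, then $0$ is a multiple eigenvalue of some $Q\in\partial\mathcal B(P,\varepsilon,w)$. Furthermore, in cases (i) and (ii), if $s_n(\mu)$ is a simple singular value of $P(\mu)$, then $\mu$ is a defective eigenvalue of $\hat Q$ and of $\tilde Q$, with geometric multiplicity $1$. -/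

import Mathlib

open scoped Matrix

noncomputable section

namespace MatPoly

/-- The coefficients `P_0, …, P_m` of an `n × n` complex matrix polynomial of degree at most `m`. -/
abbrev Coeffs (n m : ℕ) : Type := Fin (m + 1) → Matrix (Fin n) (Fin n) ℂ

/-- The matrix `P(z) = ∑ j, z ^ j P_j`. -/
def eval {n m : ℕ} (P : Coeffs n m) (z : ℂ) : Matrix (Fin n) (Fin n) ℂ :=
  ∑ j : Fin (m + 1), z ^ (j : ℕ) • P j

/-- The scalar polynomial `det P(X)`. -/
def detPoly {n m : ℕ} (P : Coeffs n m) : Polynomial ℂ :=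
  Matrix.det (∑ j : Fin (m + 1), (Polynomial.X : Polynomial ℂ) ^ (j : ℕ) • (P j).map Polynomial.C)

/-- Algebraic multiplicity of `μ`: its multiplicity as a zero of `det P(X)`. -/
def algMult {n m : ℕ} (P : Coeffs n m) (μ : ℂ) : ℕ := (detPoly P).rootMultiplicity μ

/-- Geometric multiplicity of `μ`: the dimension of the null space of `P(μ)`. -/
def geomMult {n m : ℕ} (P : Coeffs n m) (μ : ℂ) : ℕ :=
  Module.finrank ℂ (LinearMap.ker (Matrix.toLin' (eval P μ)))

/-- `μ` is a multiple eigenvalue of `P`. (If `det P(X)` is the zero polynomial this is false.) -/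
def IsMultipleEigenvalue {n m : ℕ} (P : Coeffs n m) (μ : ℂ) : Prop := 2 ≤ algMult P μ

/-- `μ` is a defective (multiple) eigenvalue of `P`. -/
def IsDefectiveEigenvalue {n m : ℕ} (P : Coeffs n m) (μ : ℂ) : Prop :=
  IsMultipleEigenvalue P μ ∧ geomMult P μ < algMult P μ

/-- The value `w(x) = ∑ j, w_j x ^ j` of the weight polynomial. -/
def weightEval {m : ℕ} (w : Fin (m + 1) → ℝ) (x : ℝ) : ℝ := ∑ j, w j * x ^ (j : ℕ)

/-- The weight polynomial is the constant `w_0`. -/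
def IsConstWeight {m : ℕ} (w : Fin (m + 1) → ℝ) : Prop := ∀ j, j ≠ 0 → w j = 0

/-- The spectral matrix norm (subordinate to the Euclidean vector norm). -/
def specNorm {n : ℕ} (A : Matrix (Fin n) (Fin n) ℂ) : ℝ :=
  ‖Matrix.toEuclideanCLM (n := Fin n) (𝕜 := ℂ) A‖

/-- The class `B(P, ε, w)` of admissible perturbations of `P`. -/
def pertBall {n m : ℕ} (P : Coeffs n m) (ε : ℝ) (w : Fin (m + 1) → ℝ) : Set (Coeffs n m) :=
  {Q | ∀ j, specNorm (Q j - P j) ≤ ε * w j}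

/-- The boundary `∂B(P, ε, w)`: some bound is attained. Only indices with `w j > 0` count, since
for `w j = 0` the bound is trivially attained; so this is the complement in `B(P, ε, w)` of the
set where all bounds with `w j > 0` are strict (the relative interior). -/
def pertBoundary {n m : ℕ} (P : Coeffs n m) (ε : ℝ) (w : Fin (m + 1) → ℝ) : Set (Coeffs n m) :=
  {Q | Q ∈ pertBall P ε w ∧ ∃ j, 0 < w j ∧ specNorm (Q j - P j) = ε * w j}

/-- The `ε`-pseudospectrum of `P` with respect to the weight `w`. -/
def pseudospectrum {n m : ℕ} (P : Coeffs n m) (w : Fin (m + 1) → ℝ) (ε : ℝ) : Set ℂ :=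
  {z | ∃ Q ∈ pertBall P ε w, (eval Q z).det = 0}

/-- The singular values of `A` in non-increasing order (`j = 0` is the largest). -/
def singVal {n : ℕ} (A : Matrix (Fin n) (Fin n) ℂ) (j : Fin n) : ℝ :=
  (Matrix.toEuclideanLin A).singularValues j

/-- The smallest singular value `s_n` of an `n × n` matrix. -/
def minSingVal {n : ℕ} (A : Matrix (Fin n) (Fin n) ℂ) : ℝ :=
  (Matrix.toEuclideanLin A).singularValues (n - 1)

/-- The smallest singular value of `A` is simple: it occurs exactly once among the `n` singular
values. -/
def MinSingValSimple {n : ℕ} (A : Matrix (Fin n) (Fin n) ℂ) : Prop :=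
  ∃! j : Fin n, singVal A j = minSingVal A

/-- The columns `u_j` of `U` and `v_j` of `V` are orthonormal systems of left and right singular
vectors of `A`: `A v_j = s_j u_j` for all `j`. -/
def AreSingularVectors {n : ℕ} (A U V : Matrix (Fin n) (Fin n) ℂ) : Prop :=
  U ∈ Matrix.unitaryGroup (Fin n) ℂ ∧ V ∈ Matrix.unitaryGroup (Fin n) ℂ ∧
    ∀ j, A *ᵥ V.col j = (singVal A j : ℂ) • U.col j

/-- `Ẑ = [u_1 ⋯ u_n] [v_1 ⋯ v_n]^*`. -/
def Zhat {n : ℕ} (U V : Matrix (Fin n) (Fin n) ℂ) : Matrix (Fin n) (Fin n) ℂ := U * Vᴴ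

open Classical in
/-- `Z̃ = ∑ u_j v_j^*`, the sum being over the indices with `s_j = s_n`. -/
def Ztilde {n : ℕ} (A U V : Matrix (Fin n) (Fin n) ℂ) : Matrix (Fin n) (Fin n) ℂ :=
  ∑ j, if singVal A j = minSingVal A then
    Matrix.vecMulVec (U.col j) (star (V.col j)) else 0

/-- The perturbation of `P` with coefficients `P_j + Δ_j`, where
`Δ_j = (conj μ / |μ|) ^ j * w_j / w(|μ|) * E` and `E = - s_n(P(μ)) Z`. For `μ = 0` the quotient
`conj μ / |μ|` is `0` and its `0`-th power is `1`. -/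
def pertAt {n m : ℕ} (P : Coeffs n m) (w : Fin (m + 1) → ℝ) (μ : ℂ)
    (Z : Matrix (Fin n) (Fin n) ℂ) : Coeffs n m :=
  fun j => P j + (((starRingEnd ℂ) μ / (‖μ‖ : ℂ)) ^ (j : ℕ) *
    ((w j : ℂ) / (weightEval w ‖μ‖ : ℂ))) • (-((minSingVal (eval P μ) : ℂ) • Z))

/-- The perturbation `Q̂` of `P` built at `μ` from the singular vectors `U`, `V` of `P(μ)`. -/
def Qhat {n m : ℕ} (P : Coeffs n m) (w : Fin (m + 1) → ℝ) (μ : ℂ)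
    (U V : Matrix (Fin n) (Fin n) ℂ) : Coeffs n m :=
  pertAt P w μ (Zhat U V)

/-- The perturbation `Q̃` of `P` built at `μ` from the singular vectors `U`, `V` of `P(μ)`. -/
def Qtilde {n m : ℕ} (P : Coeffs n m) (w : Fin (m + 1) → ℝ) (μ : ℂ)
    (U V : Matrix (Fin n) (Fin n) ℂ) : Coeffs n m :=
  pertAt P w μ (Ztilde (eval P μ) U V)

/-- `C` is a connected component of the plane set `S`. -/
def IsComponentOf (C S : Set ℂ) : Prop := ∃ z ∈ S, C = connectedComponentIn S z

/-- `C δ`, for `δ₀ < δ < ε`, is a connected component of `Λ δ` that grows with `δ`, and `G` is the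
closed set which it fills up as `δ` increases to `ε`. -/
def GrowsTo (Λ : ℝ → Set ℂ) (δ₀ ε : ℝ) (C : ℝ → Set ℂ) (G : Set ℂ) : Prop :=
  (∀ δ ∈ Set.Ioo δ₀ ε, IsComponentOf (C δ) (Λ δ)) ∧ MonotoneOn C (Set.Ioo δ₀ ε) ∧
    G = closure (⋃ δ ∈ Set.Ioo δ₀ ε, C δ)

/-- As the parameter of the growing family `Λ` increases to `ε`, two components of `Λ` that are
different below `ε` grow to `G₁` and `G₂`, and these meet at `μ`. -/
def ComponentsMeetAt (Λ : ℝ → Set ℂ) (ε : ℝ) (G₁ G₂ : Set ℂ) (μ : ℂ) : Prop :=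
  ∃ δ₀ : ℝ, 0 ≤ δ₀ ∧ δ₀ < ε ∧ ∃ C₁ C₂ : ℝ → Set ℂ,
    GrowsTo Λ δ₀ ε C₁ G₁ ∧ GrowsTo Λ δ₀ ε C₂ G₂ ∧
    (∀ δ ∈ Set.Ioo δ₀ ε, C₁ δ ≠ C₂ δ) ∧ μ ∈ G₁ ∩ G₂

end MatPoly

end

open scoped Matrix

noncomputable section

namespace MatPoly

open Filter Topology Metric

/-! Let `S` be the set where `s_n(P(z)) < ε w(|z|)`. A compact connected subset of `S` already lies
in the pseudospectrum of some level below `ε` (`exists_lt_subset_pseudospectrum`). Hence it cannot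
join points of two components that stay different below `ε`, and a meeting point satisfies
`NotLocallyJoined` (`ComponentsMeetAt.notLocallyJoined`).

This forces `s_n(P(μ)) = ε w(|μ|)`: with `>` the point `μ` has a neighbourhood free of `S`, with `<`
a disc inside `S`. So the perturbations have norm on the boundary and are singular at `μ`. If `s_n`
is multiple, `Q(μ)` has nullity at least two, and `det Q` a double zero. If `s_n` is simple, no
direction `d` may decrease `s_n(P(z)) - ε w(|z|)` to first order (`dini_le_of_notLocallyJoined`):
otherwise any two nearby points of `S` could be pushed along `d` within `S` into one disc contained
in `S`. The derivative of `s_n` is never taken; the function `‖P(z)x‖²` is differentiated with the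
vector `x` held fixed.

For `μ ≠ 0` the absence of descent directions gives `u_n^* P'(μ) v_n = ε w'(|μ|) conj μ / |μ|`,
which says exactly that `u_n^* Q'(μ) v_n = 0`; by `sq_dvd_det` the zero of `det Q` is double. At
`0`, where `|z|` has a corner, only `|u_n^* P'(0) v_n| ≤ ε w_1` remains. For constant `w` this entry
is zero; otherwise a change of `P_1` within its bound cancels it. `IsMinWeight` treats `Ẑ` and `Z̃`
at once. -/

/-- Arbitrarily close to `μ` there are two points of `S` that no compact connected subset of `S`
joins. -/
def NotLocallyJoined (S : Set ℂ) (μ : ℂ) : Prop :=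
  ∀ U ∈ 𝓝 μ, ∃ p₁ ∈ U ∩ S, ∃ p₂ ∈ U ∩ S,
    ∀ K ⊆ S, IsCompact K → IsPreconnected K → p₁ ∈ K → p₂ ∉ K

/-! ### Sublevel sets of `‖T z x‖²` that are not locally joined -/

section Analytic

variable {E : Type*} [NormedAddCommGroup E] [InnerProductSpace ℂ E]

/-- The points `z` at which some unit vector `x` satisfies `‖T z x‖ ^ 2 < q z`. -/
def strictSublevel (T : ℂ → E →L[ℂ] E) (q : ℂ → ℝ) : Set ℂ :=
  {z | ∃ x, ‖x‖ = 1 ∧ ‖T z x‖ ^ 2 < q z}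

theorem continuous_norm_sq_apply {T : ℂ → E →L[ℂ] E} (hT : Continuous T) :
    Continuous fun y : ℂ × E => ‖T y.1 y.2‖ ^ 2 :=
  (((hT.comp continuous_fst).clm_apply continuous_snd).norm).pow 2

theorem eventually_forall_lt_norm_sq {T : ℂ → E →L[ℂ] E} (hT : Continuous T) {q : ℂ → ℝ}
    (hq : Continuous q) {K : Set E} (hK : IsCompact K) {μ : ℂ}
    (h : ∀ x ∈ K, q μ < ‖T μ x‖ ^ 2) : ∀ᶠ p in 𝓝 μ, ∀ x ∈ K, q p < ‖T p x‖ ^ 2 := by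
  refine hK.eventually_forall_of_forall_eventually fun x hx => ?_
  exact ((hq.comp continuous_fst).continuousAt).eventually_lt
    (continuous_norm_sq_apply hT).continuousAt (h x hx)

/-- Otherwise compactness of the unit sphere would keep a whole neighbourhood of `μ` out of the
sublevel set. -/
theorem exists_norm_sq_le_of_notLocallyJoined [ProperSpace E] {T : ℂ → E →L[ℂ] E}
    (hT : Continuous T) {q : ℂ → ℝ} (hq : Continuous q) {μ : ℂ}
    (h : NotLocallyJoined (strictSublevel T q) μ) : ∃ x, ‖x‖ = 1 ∧ ‖T μ x‖ ^ 2 ≤ q μ := by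
  by_contra! hcon
  obtain ⟨p, ⟨hp, x, hx, hlt⟩, -⟩ := h _ (eventually_forall_lt_norm_sq hT hq
    (isCompact_sphere (0 : E) 1) fun x hx => hcon x (by simpa using hx))
  exact lt_asymm hlt (hp x (by simpa using hx))

/-- A single vector strictly below the bound at `μ` stays below it on a closed disc, which joins all
of its points. -/
theorem le_norm_sq_of_notLocallyJoined {T : ℂ → E →L[ℂ] E}
    (hT : Continuous T) {q : ℂ → ℝ} (hq : Continuous q) {μ : ℂ}
    (h : NotLocallyJoined (strictSublevel T q) μ) {x : E} (hx : ‖x‖ = 1) :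
    q μ ≤ ‖T μ x‖ ^ 2 := by
  by_contra! hcon
  have h1 : ∀ᶠ z in 𝓝 μ, ‖T z x‖ ^ 2 < q z :=
    ((continuous_norm_sq_apply hT).comp
      (continuous_id.prodMk continuous_const)).continuousAt.eventually_lt hq.continuousAt hcon
  obtain ⟨r, hr, hb⟩ := Metric.nhds_basis_closedBall.eventually_iff.1 h1
  obtain ⟨p₁, hp₁, p₂, hp₂, hK⟩ := h _ (closedBall_mem_nhds μ hr)
  exact hK (closedBall μ r) (fun z hz => ⟨x, hx, hb hz⟩) (isCompact_closedBall _ _)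
    (convex_closedBall μ r).isPreconnected hp₁.1 hp₂.1

/-- Unit vectors with no phase multiple near `v` form a compact set. On it the bound is strictly
exceeded at `μ`, hence also near `μ`. -/
theorem eventually_exists_phase [ProperSpace E] {T : ℂ → E →L[ℂ] E} (hT : Continuous T)
    {q : ℂ → ℝ} (hq : Continuous q) {μ : ℂ} {v : E}
    (huniq : ∀ x, ‖x‖ = 1 → ‖T μ x‖ ^ 2 ≤ q μ → ∃ c : ℂ, ‖c‖ = 1 ∧ c • x = v) {r : ℝ}
    (hr : 0 < r) : ∀ᶠ p in 𝓝 μ, ∀ x, ‖x‖ = 1 → ‖T p x‖ ^ 2 < q p →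
      ∃ c : ℂ, ‖c‖ = 1 ∧ c • x ∈ ball v r := by
  have hcl : IsClosed {x : E | ∀ c : ℂ, ‖c‖ = 1 → c • x ∉ ball v r} := by
    simp only [Set.ofPred_forall]
    refine isClosed_iInter fun c => isClosed_iInter fun _ => ?_
    exact (isOpen_ball.preimage (continuous_const_smul c)).isClosed_compl
  have hK := (isCompact_sphere (0 : E) 1).inter_right hcl
  filter_upwards [eventually_forall_lt_norm_sq hT hq hK (μ := μ) (by
    rintro x ⟨hx, hc⟩
    by_contra! hle
    obtain ⟨c, hc1, rfl⟩ := huniq x (by simpa using hx) hle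
    exact hc c hc1 (mem_ball_self hr))] with p hp x hx hlt
  by_contra! hcon
  exact lt_asymm hlt (hp x ⟨by simpa using hx, hcon⟩)

/-- Strict differentiability makes the estimate uniform in base point and vector. This is needed
because the points to be moved are not `μ`, and each comes with its own vector near `v`. -/
theorem eventually_norm_sq_le_of_hasStrictDerivAt {T : ℂ → E →L[ℂ] E} {T' : E →L[ℂ] E} {μ : ℂ}
    (hT : HasStrictDerivAt T T' μ) (v : E) (d : ℂ) {η : ℝ} (hη : 0 < η) :
    ∀ᶠ y : (ℂ × ℝ) × E in 𝓝 ((μ, 0), v), 0 ≤ y.1.2 →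
      ‖T (y.1.1 + y.1.2 * d) y.2‖ ^ 2 ≤ ‖T y.1.1 y.2‖ ^ 2 +
        y.1.2 * (2 * (d * inner ℂ (T μ v) (T' v)).re + η) := by
  have h1 : HasStrictFDerivAt (fun y : ℂ × E => T y.1 y.2) _ (μ, v) :=
    (hT.hasStrictFDerivAt.comp (μ, v) hasStrictFDerivAt_fst).clm_apply hasStrictFDerivAt_snd
  let _ := InnerProductSpace.complexToReal (G := E)
  have h2 := (hasStrictFDerivAt_norm_sq (T μ v)).comp (μ, v) (h1.restrictScalars ℝ)
  have h3 := h2.isLittleO.def (c := η / (‖d‖ + 1)) (by positivity)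
  -- The two points compared share the vector `y.2`, so the derivative in the vector variable drops
  -- out.
  have htend : Tendsto (fun y : (ℂ × ℝ) × E => (((y.1.1 + y.1.2 * d, y.2), (y.1.1, y.2)) :
      (ℂ × E) × (ℂ × E))) (𝓝 ((μ, 0), v)) (𝓝 ((μ, v), (μ, v))) := by
    have : Continuous (fun y : (ℂ × ℝ) × E => (((y.1.1 + y.1.2 * d, y.2), (y.1.1, y.2)) :
      (ℂ × E) × (ℂ × E))) := by fun_prop
    simpa using this.tendsto ((μ, 0), v)
  filter_upwards [htend.eventually h3] with y hy ht
  have h4 := (le_abs_self _).trans hy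
  simp only [Prod.mk_sub_mk, add_sub_cancel_left, sub_self,
    ContinuousLinearMap.comp_apply, Prod.norm_mk, norm_zero] at h4
  rw [max_eq_left (norm_nonneg _), norm_mul, Complex.norm_real, Real.norm_of_nonneg ht] at h4
  have h5 : η / (‖d‖ + 1) * (y.1.2 * ‖d‖) ≤ y.1.2 * η := by
    rw [div_mul_eq_mul_div, div_le_iff₀ (by positivity)]
    nlinarith [mul_nonneg ht hη.le]
  have h6 : ∀ b : E, inner ℝ (T μ v) (((y.1.2 : ℂ) * d) • b)
      = y.1.2 * (d * inner ℂ (T μ v) b).re := by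
    intro b
    rw [real_inner_eq_re_inner ℂ, inner_smul_right]
    simp only [RCLike.re_eq_complex_re, mul_assoc, Complex.re_ofReal_mul]
  simp [h6] at h4
  rw [Complex.mul_re]
  linarith

/-- Let `v` be, up to a phase, the only unit vector with `‖T μ v‖ ^ 2 ≤ q μ`. If the sublevel set
is not locally connected at `μ`, then no direction is a descent direction. -/
theorem dini_le_of_notLocallyJoined [ProperSpace E] {T : ℂ → E →L[ℂ] E} {T' : E →L[ℂ] E} {μ : ℂ}
    (hT : HasStrictDerivAt T T' μ) (hTc : Continuous T) {q : ℂ → ℝ} (hq : Continuous q)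
    {d : ℂ} {β : ℝ} (hdini : ∀ η > 0, ∀ᶠ y : ℂ × ℝ in 𝓝 (μ, 0), 0 ≤ y.2 →
      q y.1 + y.2 * (β - η) ≤ q (y.1 + y.2 * d))
    {v : E} (hv : ‖v‖ = 1) (hmin : ‖T μ v‖ ^ 2 ≤ q μ)
    (huniq : ∀ x, ‖x‖ = 1 → ‖T μ x‖ ^ 2 ≤ q μ → ∃ c : ℂ, ‖c‖ = 1 ∧ c • x = v)
    (h : NotLocallyJoined (strictSublevel T q) μ) :
    β ≤ 2 * (d * inner ℂ (T μ v) (T' v)).re := by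
  by_contra! hcon
  -- The gap is split in three: one share is lost to the error of `T`, one to that of `q`, and the
  -- third is the rate of descent.
  obtain ⟨c, hc⟩ : ∃ c, c = (β - 2 * (d * inner ℂ (T μ v) (T' v)).re) / 3 := ⟨_, rfl⟩
  have hc0 : 0 < c := by rw [hc]; linarith
  have key : ∀ᶠ y : (ℂ × ℝ) × E in 𝓝 ((μ, 0), v), 0 ≤ y.1.2 →
      ‖T (y.1.1 + y.1.2 * d) y.2‖ ^ 2 - q (y.1.1 + y.1.2 * d) ≤
        ‖T y.1.1 y.2‖ ^ 2 - q y.1.1 - y.1.2 * c := by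
    have ht : Tendsto (Prod.fst : (ℂ × ℝ) × E → ℂ × ℝ) (𝓝 ((μ, 0), v)) (𝓝 (μ, 0)) :=
      continuous_fst.tendsto _
    filter_upwards [eventually_norm_sq_le_of_hasStrictDerivAt hT v d hc0,
      ht.eventually (hdini c hc0)] with y h1 h2 ht
    have h3 := h1 ht
    have h4 := h2 ht
    have h5 : β = 2 * (d * inner ℂ (T μ v) (T' v)).re + 3 * c := by rw [hc]; ring
    rw [h5] at h4
    linarith
  obtain ⟨r, hr, hball⟩ := Metric.eventually_nhds_iff.1 key
  replace hball : ∀ p t x, dist p μ < r → 0 ≤ t → t < r → dist x v < r →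
      ‖T (p + (t : ℝ) * d) x‖ ^ 2 - q (p + t * d) ≤ ‖T p x‖ ^ 2 - q p - t * c := by
    intro p t x hp h0 ht hx
    refine hball (y := ((p, t), x)) ?_ h0
    simp [Prod.dist_eq, hp, hx, abs_of_nonneg h0, ht]
  -- One step length serves all nearby points. At `μ + t₀ * d` the vector `v` is strictly below the
  -- bound, so a disc of radius `s` around that point lies in the sublevel set.
  set t₀ : ℝ := r / 2 with ht₀
  have ht₀0 : 0 < t₀ := by positivity
  have hneg : ‖T (μ + t₀ * d) v‖ ^ 2 < q (μ + t₀ * d) := by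
    have := hball μ t₀ v (by simpa using hr) ht₀0.le (by linarith) (by simpa using hr)
    nlinarith [mul_pos ht₀0 hc0]
  have hnear : ∀ᶠ z in 𝓝 (μ + t₀ * d), ‖T z v‖ ^ 2 < q z :=
    ((continuous_norm_sq_apply hTc).comp
      (continuous_id.prodMk continuous_const)).continuousAt.eventually_lt hq.continuousAt hneg
  obtain ⟨s, hs, hsb⟩ := Metric.nhds_basis_ball.eventually_iff.1 hnear
  obtain ⟨p₁, ⟨hU₁, x₁, hx₁, hlt₁⟩, p₂, ⟨hU₂, x₂, hx₂, hlt₂⟩, hK⟩ :=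
    h _ (inter_mem (inter_mem (ball_mem_nhds μ hr) (ball_mem_nhds μ hs))
      (eventually_exists_phase hTc hq huniq hr))
  have descend : ∀ p x, p ∈ (ball μ r ∩ ball μ s) ∩ {p | ∀ x, ‖x‖ = 1 → ‖T p x‖ ^ 2 < q p →
      ∃ c : ℂ, ‖c‖ = 1 ∧ c • x ∈ ball v r} → ‖x‖ = 1 → ‖T p x‖ ^ 2 < q p →
      segment ℝ p (p + t₀ * d) ⊆ strictSublevel T q := by
    rintro p x ⟨⟨hpr, hps⟩, hph⟩ hx hlt z hz
    obtain ⟨b, hb, hbx⟩ := hph x hx hlt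
    rw [segment_eq_image'] at hz
    obtain ⟨θ, ⟨hθ0, hθ1⟩, rfl⟩ := hz
    have h1 := hball p (θ * t₀) (b • x) hpr (by positivity) (by nlinarith) hbx
    have h2 : p + ((θ * t₀ : ℝ) : ℂ) * d = p + θ • (p + t₀ * d - p) := by
      simp [mul_assoc]
    rw [h2] at h1
    refine ⟨b • x, by rw [norm_smul, hb, hx, one_mul], ?_⟩
    have h3 : ‖T p (b • x)‖ = ‖T p x‖ := by rw [map_smul, norm_smul, hb, one_mul]
    rw [h3] at h1
    have : 0 ≤ θ * t₀ * c := by positivity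
    linarith
  have hend : ∀ p, p ∈ ball μ s → p + t₀ * d ∈ ball (μ + t₀ * d) s := by
    intro p hp
    simpa [mem_ball, dist_eq_norm] using hp
  -- Down from `p₁` along `d`, across the disc around `μ + t₀ * d`, and back up to `p₂`.
  refine hK (segment ℝ p₁ (p₁ + t₀ * d) ∪ segment ℝ (p₁ + t₀ * d) (p₂ + t₀ * d) ∪
    segment ℝ p₂ (p₂ + t₀ * d)) ?_ ?_ ?_ ?_ ?_
  · refine Set.union_subset (Set.union_subset (descend p₁ x₁ hU₁ hx₁ hlt₁) fun z hz => ?_)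
      (descend p₂ x₂ hU₂ hx₂ hlt₂)
    exact ⟨v, hv, hsb ((convex_ball _ _).segment_subset (hend _ hU₁.1.2) (hend _ hU₂.1.2) hz)⟩
  · have hseg : ∀ a b : ℂ, IsCompact (segment ℝ a b) := fun a b => by
      rw [segment_eq_image']
      exact isCompact_Icc.image (by fun_prop)
    exact ((hseg _ _).union (hseg _ _)).union (hseg _ _)
  · have hseg : ∀ a b : ℂ, IsPreconnected (segment ℝ a b) := fun a b =>
      (convex_segment a b).isPreconnected
    refine ((hseg _ _).union (p₁ + t₀ * d) (right_mem_segment _ _ _) (left_mem_segment _ _ _)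
      (hseg _ _)).union (p₂ + t₀ * d) (Or.inr (right_mem_segment _ _ _)) (right_mem_segment _ _ _)
      (hseg _ _)
  · exact Or.inl (Or.inl (left_mem_segment _ _ _))
  · exact Or.inr (left_mem_segment _ _ _)

end Analytic

open Polynomial

/-! ### Double zeros of the determinant of a matrix polynomial -/

section Determinant

variable {n m : ℕ}

/-- The derivative `P'(z)` of a matrix polynomial. -/
def evalDeriv (P : Coeffs n m) (z : ℂ) : Matrix (Fin n) (Fin n) ℂ :=
  ∑ j : Fin (m + 1), ((j : ℕ) * z ^ ((j : ℕ) - 1) : ℂ) • P j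

/-- The matrix polynomial as a matrix with polynomial entries. -/
def polyMatrix (P : Coeffs n m) : Matrix (Fin n) (Fin n) ℂ[X] :=
  ∑ j : Fin (m + 1), (X : ℂ[X]) ^ (j : ℕ) • (P j).map C

theorem polyMatrix_apply (P : Coeffs n m) (a b : Fin n) :
    polyMatrix P a b = ∑ j : Fin (m + 1), (X : ℂ[X]) ^ (j : ℕ) * C (P j a b) := by
  simp [polyMatrix, Matrix.sum_apply]

theorem eval_polyMatrix_apply (P : Coeffs n m) (z : ℂ) (a b : Fin n) :
    (polyMatrix P a b).eval z = eval P z a b := by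
  simp [polyMatrix_apply, eval, Matrix.sum_apply, eval_finsetSum, -X_pow_mul_C]

theorem eval_derivative_polyMatrix_apply (P : Coeffs n m) (z : ℂ) (a b : Fin n) :
    (derivative (polyMatrix P a b)).eval z = evalDeriv P z a b := by
  simp [polyMatrix_apply, evalDeriv, Matrix.sum_apply, eval_finsetSum, derivative_X_pow,
    -X_pow_mul_C]
  exact Finset.sum_congr rfl fun j _ => mul_right_comm _ _ _

theorem eval_detPoly (P : Coeffs n m) (z : ℂ) : (detPoly P).eval z = (eval P z).det := by
  change (polyMatrix P).det.eval z = _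
  rw [← coe_evalRingHom, RingHom.map_det]
  congr 1
  ext a b
  exact eval_polyMatrix_apply P z a b

theorem eval_mul_mul (A : Matrix (Fin n) (Fin n) ℂ) (P : Coeffs n m)
    (B : Matrix (Fin n) (Fin n) ℂ) (z : ℂ) :
    eval (fun j => A * P j * B) z = A * eval P z * B := by
  simp [eval, Matrix.mul_sum, Matrix.sum_mul]

theorem evalDeriv_mul_mul (A : Matrix (Fin n) (Fin n) ℂ) (P : Coeffs n m)
    (B : Matrix (Fin n) (Fin n) ℂ) (z : ℂ) :
    evalDeriv (fun j => A * P j * B) z = A * evalDeriv P z * B := by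
  simp [evalDeriv, Matrix.mul_sum, Matrix.sum_mul]

theorem detPoly_mul_mul (A : Matrix (Fin n) (Fin n) ℂ) (P : Coeffs n m)
    (B : Matrix (Fin n) (Fin n) ℂ) :
    detPoly (fun j => A * P j * B) = C A.det * detPoly P * C B.det := by
  have h : polyMatrix (fun j => A * P j * B) = A.map C * polyMatrix P * B.map C := by
    simp [polyMatrix, Matrix.mul_sum, Matrix.sum_mul, Matrix.map_mul]
  change (polyMatrix _).det = _ * (polyMatrix P).det * _
  rw [h, Matrix.det_mul, Matrix.det_mul, RingHom.map_det, RingHom.map_det]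
  rfl

/-- Row `k` vanishes at `μ`, so it yields one factor `X - μ`. In the quotient matrix at `μ`, either
row `j` is zero, or column `k` is: its off-diagonal entries come from `diagonal D`, and its diagonal
entry is the derivative of `M k k`. -/
theorem sq_dvd_det {M : Matrix (Fin n) (Fin n) ℂ[X]} {μ : ℂ} {D : Fin n → ℂ}
    (hM : ∀ a b, (M a b).eval μ = Matrix.diagonal D a b) {k : Fin n} (hk : D k = 0)
    (h : (∃ j, j ≠ k ∧ D j = 0) ∨ (derivative (M k k)).eval μ = 0) :
    (X - C μ) ^ 2 ∣ M.det := by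
  have hdvd : ∀ b, (X - C μ) ∣ M k b := fun b => by
    rw [dvd_iff_isRoot, IsRoot.def, hM]
    by_cases hb : k = b
    · rw [← hb, Matrix.diagonal_apply_eq, hk]
    · rw [Matrix.diagonal_apply_ne _ hb]
  choose r hr using hdvd
  have h1 : M = M.updateRow k ((X - C μ) • r) := by
    ext1 a b
    by_cases ha : a = k
    · subst ha; simp [hr]
    · simp [Matrix.updateRow_ne ha]
  rw [h1, Matrix.det_updateRow_smul, sq]
  refine mul_dvd_mul_left _ ?_
  rw [dvd_iff_isRoot, IsRoot.def, ← coe_evalRingHom, RingHom.map_det]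
  rcases h with ⟨j, hjk, hj⟩ | h
  · refine Matrix.det_eq_zero_of_row_eq_zero j fun b => ?_
    rw [RingHom.mapMatrix_apply, Matrix.map_apply, Matrix.updateRow_ne hjk, coe_evalRingHom, hM]
    by_cases hb : j = b
    · rw [← hb, Matrix.diagonal_apply_eq, hj]
    · rw [Matrix.diagonal_apply_ne _ hb]
  · refine Matrix.det_eq_zero_of_column_eq_zero k fun a => ?_
    rw [RingHom.mapMatrix_apply, Matrix.map_apply, coe_evalRingHom]
    by_cases ha : a = k
    · rw [ha, Matrix.updateRow_self]
      rw [hr] at h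
      simpa [derivative_mul] using h
    · rw [Matrix.updateRow_ne ha, hM, Matrix.diagonal_apply_ne _ ha]

theorem mul_star_self_of_mem_unitaryGroup {U : Matrix (Fin n) (Fin n) ℂ}
    (hU : U ∈ Matrix.unitaryGroup (Fin n) ℂ) : U * Uᴴ = 1 :=
  Matrix.mem_unitaryGroup_iff.1 hU

theorem star_mul_self_of_mem_unitaryGroup {U : Matrix (Fin n) (Fin n) ℂ}
    (hU : U ∈ Matrix.unitaryGroup (Fin n) ℂ) : Uᴴ * U = 1 :=
  Matrix.mem_unitaryGroup_iff'.1 hU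

theorem two_le_algMult {Q : Coeffs n m} {μ : ℂ} (hdet : detPoly Q ≠ 0)
    {U V : Matrix (Fin n) (Fin n) ℂ} (hU : U ∈ Matrix.unitaryGroup (Fin n) ℂ)
    (hV : V ∈ Matrix.unitaryGroup (Fin n) ℂ) {D : Fin n → ℂ}
    (hQ : eval Q μ = U * Matrix.diagonal D * Vᴴ) {k : Fin n} (hk : D k = 0)
    (h : (∃ j, j ≠ k ∧ D j = 0) ∨ (Uᴴ * evalDeriv Q μ * V) k k = 0) : 2 ≤ algMult Q μ := by
  have hU1 := star_mul_self_of_mem_unitaryGroup hU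
  have hV1 := star_mul_self_of_mem_unitaryGroup hV
  have hdvd : (X - C μ) ^ 2 ∣ (polyMatrix fun j => Uᴴ * Q j * V).det := by
    refine sq_dvd_det (D := D) (fun a b => ?_) hk ?_
    · rw [eval_polyMatrix_apply, eval_mul_mul, hQ, Matrix.mul_assoc U, ← Matrix.mul_assoc Uᴴ, hU1,
        Matrix.one_mul, Matrix.mul_assoc, hV1, Matrix.mul_one]
    · rwa [eval_derivative_polyMatrix_apply, evalDeriv_mul_mul]
  rw [algMult, le_rootMultiplicity_iff hdet]
  have hunit : ∀ {A B : Matrix (Fin n) (Fin n) ℂ}, A * B = 1 → IsUnit (C A.det) := fun hAB =>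
    isUnit_C.2 (IsUnit.of_mul_eq_one _ (by rw [← Matrix.det_mul, hAB, Matrix.det_one]))
  have h2 : (X - C μ) ^ 2 ∣ C Uᴴ.det * detPoly Q * C V.det := by
    rw [← detPoly_mul_mul]; exact hdvd
  rwa [(hunit (mul_star_self_of_mem_unitaryGroup hV)).dvd_mul_right, (hunit hU1).dvd_mul_left] at h2

end Determinant

/-! ### Singular vectors and the smallest singular value -/

section SingularValues

variable {n : ℕ}

open WithLp

theorem norm_toLp_mulVec {U : Matrix (Fin n) (Fin n) ℂ} (hU : U ∈ Matrix.unitaryGroup (Fin n) ℂ)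
    (x : Fin n → ℂ) : ‖toLp 2 (U *ᵥ x)‖ = ‖toLp 2 x‖ := by
  have h : Matrix.toEuclideanCLM (n := Fin n) (𝕜 := ℂ) U ∈ unitary _ :=
    Unitary.map_mem Matrix.toEuclideanCLM hU
  simpa using ContinuousLinearMap.norm_map_of_mem_unitary h (toLp 2 x)

theorem conjTranspose_mem_unitaryGroup {U : Matrix (Fin n) (Fin n) ℂ}
    (hU : U ∈ Matrix.unitaryGroup (Fin n) ℂ) : Uᴴ ∈ Matrix.unitaryGroup (Fin n) ℂ :=
  Unitary.star_mem hU

theorem singVal_nonneg (A : Matrix (Fin n) (Fin n) ℂ) (j : Fin n) : 0 ≤ singVal A j :=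
  LinearMap.singularValues_nonneg _ _

theorem minSingVal_nonneg (A : Matrix (Fin n) (Fin n) ℂ) : 0 ≤ minSingVal A :=
  LinearMap.singularValues_nonneg _ _

theorem minSingVal_le (A : Matrix (Fin n) (Fin n) ℂ) (j : Fin n) : minSingVal A ≤ singVal A j :=
  LinearMap.singularValues_antitone _ (by omega)

theorem exists_singVal_eq_minSingVal (hn : n ≠ 0) (A : Matrix (Fin n) (Fin n) ℂ) :
    ∃ k, singVal A k = minSingVal A :=
  ⟨⟨n - 1, by omega⟩, rfl⟩

theorem AreSingularVectors.eq_mul {A U V : Matrix (Fin n) (Fin n) ℂ}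
    (h : AreSingularVectors A U V) :
    A = U * Matrix.diagonal (fun j => (singVal A j : ℂ)) * Vᴴ := by
  have h1 : A * V = U * Matrix.diagonal (fun j => (singVal A j : ℂ)) := by
    ext i j
    have := congrFun (h.2.2 j) i
    rw [Matrix.mul_diagonal]
    simpa [Matrix.mulVec, dotProduct, Matrix.mul_apply, mul_comm] using this
  rw [← h1, Matrix.mul_assoc, mul_star_self_of_mem_unitaryGroup h.2.1, Matrix.mul_one]

theorem AreSingularVectors.norm_sq {A U V : Matrix (Fin n) (Fin n) ℂ}
    (h : AreSingularVectors A U V) (x : EuclideanSpace ℂ (Fin n)) :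
    ‖Matrix.toEuclideanCLM (n := Fin n) (𝕜 := ℂ) A x‖ ^ 2 =
      ∑ j, singVal A j ^ 2 * ‖(Vᴴ *ᵥ ofLp x) j‖ ^ 2 := by
  have h1 : Matrix.toEuclideanCLM (n := Fin n) (𝕜 := ℂ) A x = toLp 2 (U *ᵥ
      (Matrix.diagonal (fun j => (singVal A j : ℂ)) *ᵥ (Vᴴ *ᵥ ofLp x))) := by
    conv_lhs => rw [h.eq_mul]
    simp only [Matrix.mulVec_mulVec, ← Matrix.mul_assoc]
    rfl
  rw [h1, norm_toLp_mulVec h.1, EuclideanSpace.norm_sq_eq]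
  refine Finset.sum_congr rfl fun j _ => ?_
  simp [Matrix.mulVec_diagonal, mul_pow]

theorem AreSingularVectors.sum_sq {A U V : Matrix (Fin n) (Fin n) ℂ}
    (h : AreSingularVectors A U V) (x : EuclideanSpace ℂ (Fin n)) :
    ∑ j, ‖(Vᴴ *ᵥ ofLp x) j‖ ^ 2 = ‖x‖ ^ 2 := by
  have := norm_toLp_mulVec (conjTranspose_mem_unitaryGroup h.2.1) (ofLp x)
  rw [toLp_ofLp] at this
  rw [← this, EuclideanSpace.norm_sq_eq]

theorem norm_toLp_col {U : Matrix (Fin n) (Fin n) ℂ} (hU : U ∈ Matrix.unitaryGroup (Fin n) ℂ)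
    (j : Fin n) : ‖toLp 2 (U.col j)‖ = 1 := by
  rw [← Matrix.mulVec_single_one, norm_toLp_mulVec hU]
  simp

theorem AreSingularVectors.apply_col {A U V : Matrix (Fin n) (Fin n) ℂ}
    (h : AreSingularVectors A U V) (j : Fin n) :
    Matrix.toEuclideanCLM (n := Fin n) (𝕜 := ℂ) A (toLp 2 (V.col j)) =
      (singVal A j : ℂ) • toLp 2 (U.col j) := by
  rw [Matrix.toEuclideanCLM_toLp, h.2.2 j]
  rfl

theorem AreSingularVectors.norm_apply_col {A U V : Matrix (Fin n) (Fin n) ℂ}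
    (h : AreSingularVectors A U V) (j : Fin n) :
    ‖Matrix.toEuclideanCLM (n := Fin n) (𝕜 := ℂ) A (toLp 2 (V.col j))‖ = singVal A j := by
  rw [h.apply_col, norm_smul, norm_toLp_col h.1, mul_one, Complex.norm_real,
    Real.norm_of_nonneg (singVal_nonneg A j)]

theorem AreSingularVectors.minSingVal_sq_le {A U V : Matrix (Fin n) (Fin n) ℂ}
    (h : AreSingularVectors A U V) {x : EuclideanSpace ℂ (Fin n)} (hx : ‖x‖ = 1) :
    minSingVal A ^ 2 ≤ ‖Matrix.toEuclideanCLM (n := Fin n) (𝕜 := ℂ) A x‖ ^ 2 := by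
  calc minSingVal A ^ 2 = ∑ j, minSingVal A ^ 2 * ‖(Vᴴ *ᵥ ofLp x) j‖ ^ 2 := by
        rw [← Finset.mul_sum, h.sum_sq, hx, one_pow, mul_one]
    _ ≤ _ := by
        rw [h.norm_sq]
        refine Finset.sum_le_sum fun j _ => ?_
        have := minSingVal_le A j
        have := minSingVal_nonneg A
        gcongr

/-- If `s_n` is simple, the unit vectors at which it is attained are multiples of `v_n`. -/
theorem AreSingularVectors.exists_phase {A U V : Matrix (Fin n) (Fin n) ℂ}
    (h : AreSingularVectors A U V) {k : Fin n}
    (hk : ∀ j, j ≠ k → minSingVal A < singVal A j) {x : EuclideanSpace ℂ (Fin n)} (hx : ‖x‖ = 1)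
    (hle : ‖Matrix.toEuclideanCLM (n := Fin n) (𝕜 := ℂ) A x‖ ^ 2 ≤ minSingVal A ^ 2) :
    ∃ c : ℂ, ‖c‖ = 1 ∧ c • x = toLp 2 (V.col k) := by
  set y := Vᴴ *ᵥ ofLp x with hy
  have hzero : ∀ j, j ≠ k → y j = 0 := by
    intro j hj
    -- The sum is `‖A x‖² - s_n²` for the unit vector `x`. Its terms are nonnegative, so all of them
    -- vanish.
    have hsum : ∑ j, (singVal A j ^ 2 - minSingVal A ^ 2) * ‖y j‖ ^ 2 ≤ 0 := by
      simp only [sub_mul, Finset.sum_sub_distrib]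
      rw [← Finset.mul_sum, h.sum_sq, hx, ← h.norm_sq]
      linarith
    have hnn : ∀ j ∈ Finset.univ, 0 ≤ (singVal A j ^ 2 - minSingVal A ^ 2) * ‖y j‖ ^ 2 := by
      intro j _
      have := minSingVal_le A j
      have := minSingVal_nonneg A
      have : minSingVal A ^ 2 ≤ singVal A j ^ 2 := by gcongr
      exact mul_nonneg (by linarith) (by positivity)
    have h0 := (Finset.sum_eq_zero_iff_of_nonneg hnn).1
      (le_antisymm hsum (Finset.sum_nonneg hnn)) j (Finset.mem_univ j)
    have hlt : minSingVal A ^ 2 < singVal A j ^ 2 := by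
      have := hk j hj
      have := minSingVal_nonneg A
      gcongr
    rcases mul_eq_zero.1 h0 with h1 | h1
    · linarith
    · simpa using h1
  have hyk : ofLp x = y k • V.col k := by
    have h1 : V *ᵥ y = ofLp x := by
      rw [hy, Matrix.mulVec_mulVec, mul_star_self_of_mem_unitaryGroup h.2.1, Matrix.one_mulVec]
    have h2 : y = Pi.single k (y k) := by
      ext j
      by_cases hj : j = k
      · subst hj; simp
      · simp [hzero j hj, hj]
    rw [← h1, h2, Matrix.mulVec_single]
    ext i
    simp [mul_comm]
  have hx' : x = y k • toLp 2 (V.col k) := by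
    rw [← toLp_smul, ← hyk]
  have hn1 : ‖y k‖ = 1 := by
    have := congrArg norm hx'
    rw [norm_smul, norm_toLp_col h.2.1, mul_one, hx] at this
    exact this.symm
  refine ⟨(y k)⁻¹, by rw [norm_inv, hn1, inv_one], ?_⟩
  rw [hx', smul_smul, inv_mul_cancel₀ (by rintro h0; simp [h0] at hn1), one_smul]

theorem of_mem_unitaryGroup {f : Fin n → EuclideanSpace ℂ (Fin n)} (hf : Orthonormal ℂ f) :
    (Matrix.of fun i j => f j i) ∈ Matrix.unitaryGroup (Fin n) ℂ := by
  rw [Matrix.mem_unitaryGroup_iff']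
  ext i j
  have h := orthonormal_iff_ite.1 hf i j
  rw [Matrix.one_apply, ← h]
  simp [Matrix.mul_apply, PiLp.inner_apply, Matrix.star_apply, mul_comm]

/-- With `A` injective all singular values are positive, so normalizing the images of an eigenbasis
of `A^* A` already gives `n` orthonormal left vectors and nothing has to be completed. -/
theorem exists_areSingularVectors {A : Matrix (Fin n) (Fin n) ℂ}
    (hA : ∀ x, Matrix.toEuclideanCLM (n := Fin n) (𝕜 := ℂ) A x = 0 → x = 0) :
    ∃ U V, AreSingularVectors A U V := by
  set T := Matrix.toEuclideanLin A with hT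
  have hn : Module.finrank ℂ (EuclideanSpace ℂ (Fin n)) = n := by simp
  have hinj : Function.Injective T := by
    rw [← LinearMap.ker_eq_bot, LinearMap.ker_eq_bot']
    exact hA
  have hpos : ∀ j : Fin n, 0 < singVal A j := fun j =>
    T.injective_iff_forall_lt_finrank_singularValues_pos.1 hinj j (by rw [hn]; exact j.2)
  set b := T.isSymmetric_adjoint_comp_self.eigenvectorBasis hn with hb
  have hTb : ∀ i j, inner ℂ (T (b i)) (T (b j)) = ((singVal A j : ℂ)) ^ 2 * if i = j then 1 else 0 := by
    intro i j
    have h1 := T.isSymmetric_adjoint_comp_self.apply_eigenvectorBasis hn j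
    rw [← T.sq_singularValues_fin hn j] at h1
    rw [← LinearMap.adjoint_inner_right, ← LinearMap.comp_apply, h1, inner_smul_right,
      orthonormal_iff_ite.1 b.orthonormal i j]
    simp [singVal, hT]
  have hu : Orthonormal ℂ fun j => ((singVal A j : ℂ))⁻¹ • T (b j) := by
    rw [orthonormal_iff_ite]
    intro i j
    rw [inner_smul_left, inner_smul_right, hTb]
    have := (hpos j).ne'
    split_ifs with hij
    · subst hij
      have h0 : (singVal A i : ℂ) ≠ 0 := by exact_mod_cast this
      simp
      field_simp
    · simp
  refine ⟨_, _, of_mem_unitaryGroup hu, of_mem_unitaryGroup b.orthonormal, fun j => ?_⟩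
  have h0 : (singVal A j : ℂ) ≠ 0 := by exact_mod_cast (hpos j).ne'
  have h1 : A *ᵥ ofLp (b j) = ofLp (T (b j)) := rfl
  change A *ᵥ ofLp (b j) = (singVal A j : ℂ) • ofLp ((singVal A j : ℂ)⁻¹ • T (b j))
  rw [h1, ofLp_smul, smul_smul, mul_inv_cancel₀ h0, one_smul]

end SingularValues

open Filter Topology WithLp

/-! ### Perturbations concentrated at a point, and the pseudospectrum -/

section Perturbation

variable {n m : ℕ}

/-- The operator on Euclidean space given by `P(z)`. -/
def evalOp (P : Coeffs n m) (z : ℂ) : EuclideanSpace ℂ (Fin n) →L[ℂ] EuclideanSpace ℂ (Fin n) :=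
  Matrix.toEuclideanCLM (n := Fin n) (𝕜 := ℂ) (eval P z)

theorem evalOp_eq_sum (P : Coeffs n m) (z : ℂ) :
    evalOp P z = ∑ j : Fin (m + 1), z ^ (j : ℕ) •
      Matrix.toEuclideanCLM (n := Fin n) (𝕜 := ℂ) (P j) := by
  simp [evalOp, eval, map_sum]

theorem continuous_evalOp (P : Coeffs n m) : Continuous (evalOp P) := by
  simp only [funext (evalOp_eq_sum P)]
  fun_prop

theorem hasStrictDerivAt_evalOp (P : Coeffs n m) (z : ℂ) :
    HasStrictDerivAt (evalOp P)
      (Matrix.toEuclideanCLM (n := Fin n) (𝕜 := ℂ) (evalDeriv P z)) z := by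
  rw [funext (evalOp_eq_sum P), evalDeriv, map_sum]
  refine HasStrictDerivAt.fun_sum fun j _ => ?_
  rw [map_smul (Matrix.toEuclideanCLM (n := Fin n) (𝕜 := ℂ))]
  exact (hasStrictDerivAt_pow (j : ℕ) z).smul_const
    (Matrix.toEuclideanCLM (n := Fin n) (𝕜 := ℂ) (P j))

theorem weightEval_pos {w : Fin (m + 1) → ℝ} (hw : ∀ j, 0 ≤ w j) (hw0 : 0 < w 0) {x : ℝ}
    (hx : 0 ≤ x) : 0 < weightEval w x := by
  refine Finset.sum_pos' (fun j _ => mul_nonneg (hw j) (by positivity)) ⟨0, Finset.mem_univ _, ?_⟩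
  simpa using hw0

theorem continuous_weightEval (w : Fin (m + 1) → ℝ) : Continuous (weightEval w) := by
  unfold weightEval
  fun_prop

/-- The derivative `w'(x)` of the weight polynomial. -/
def weightDeriv (w : Fin (m + 1) → ℝ) (x : ℝ) : ℝ := ∑ j, w j * ((j : ℕ) * x ^ ((j : ℕ) - 1))

theorem hasStrictDerivAt_weightEval (w : Fin (m + 1) → ℝ) (x : ℝ) :
    HasStrictDerivAt (weightEval w) (weightDeriv w x) x :=
  HasStrictDerivAt.fun_sum fun j _ => (hasStrictDerivAt_pow (j : ℕ) x).const_mul (w j)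

theorem weightDeriv_nonneg {w : Fin (m + 1) → ℝ} (hw : ∀ j, 0 ≤ w j) {x : ℝ} (hx : 0 ≤ x) :
    0 ≤ weightDeriv w x :=
  Finset.sum_nonneg fun j _ => mul_nonneg (hw j) (by positivity)

theorem IsConstWeight.weightDeriv_eq_zero {w : Fin (m + 1) → ℝ} (hw : IsConstWeight w) (x : ℝ) :
    weightDeriv w x = 0 := by
  refine Finset.sum_eq_zero fun j _ => ?_
  by_cases hj : j = 0
  · simp [hj]
  · simp [hw j hj]

/-- The share `(conj μ / |μ|) ^ j * w_j / w(|μ|)` of the coefficient `j` in a perturbation at `μ`. -/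
def share (w : Fin (m + 1) → ℝ) (μ : ℂ) (j : Fin (m + 1)) : ℂ :=
  ((starRingEnd ℂ) μ / (‖μ‖ : ℂ)) ^ (j : ℕ) * ((w j : ℂ) / (weightEval w ‖μ‖ : ℂ))

/-- The perturbation of `P` that distributes the change `B` of `P(μ)` over the coefficients. -/
def perturb (P : Coeffs n m) (w : Fin (m + 1) → ℝ) (μ : ℂ) (B : Matrix (Fin n) (Fin n) ℂ) :
    Coeffs n m :=
  fun j => P j + share w μ j • B

theorem mul_conj_div_norm (μ : ℂ) : μ * ((starRingEnd ℂ) μ / (‖μ‖ : ℂ)) = ‖μ‖ := by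
  rcases eq_or_ne μ 0 with rfl | h
  · simp
  · have : (‖μ‖ : ℂ) ≠ 0 := by simpa using h
    field_simp
    rw [Complex.mul_conj']

theorem norm_conj_div_norm_le (μ : ℂ) : ‖(starRingEnd ℂ) μ / (‖μ‖ : ℂ)‖ ≤ 1 := by
  rw [norm_div, RCLike.norm_conj, Complex.norm_real, norm_norm]
  exact div_self_le_one _

/-- The rotations `conj μ / |μ|` align all terms: each becomes `w_j |μ|^j / w(|μ|)`. -/
theorem sum_pow_mul_share {w : Fin (m + 1) → ℝ} (hw : ∀ j, 0 ≤ w j) (hw0 : 0 < w 0) (μ : ℂ) :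
    ∑ j : Fin (m + 1), μ ^ (j : ℕ) * share w μ j = 1 := by
  have hW : (weightEval w ‖μ‖ : ℂ) ≠ 0 := by
    exact_mod_cast (weightEval_pos hw hw0 (norm_nonneg μ)).ne'
  have h1 : ∀ j : Fin (m + 1), μ ^ (j : ℕ) * share w μ j =
      ((w j * ‖μ‖ ^ (j : ℕ) : ℝ) : ℂ) / (weightEval w ‖μ‖ : ℂ) := fun j => by
    rw [share, ← mul_assoc, ← mul_pow, mul_conj_div_norm]
    push_cast
    ring
  simp only [h1, ← Finset.sum_div, ← Complex.ofReal_sum]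
  exact div_self hW

theorem sum_deriv_mul_share (w : Fin (m + 1) → ℝ) (μ : ℂ) :
    ∑ j : Fin (m + 1), ((j : ℕ) * μ ^ ((j : ℕ) - 1) : ℂ) * share w μ j =
      (starRingEnd ℂ) μ / (‖μ‖ : ℂ) * (weightDeriv w ‖μ‖ / weightEval w ‖μ‖ : ℝ) := by
  have h1 : ∀ j : Fin (m + 1), ((j : ℕ) * μ ^ ((j : ℕ) - 1) : ℂ) * share w μ j =
      (starRingEnd ℂ) μ / (‖μ‖ : ℂ) *
        ((w j * ((j : ℕ) * ‖μ‖ ^ ((j : ℕ) - 1)) / weightEval w ‖μ‖ : ℝ) : ℂ) := fun j => by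
    rw [share]
    rcases Nat.eq_zero_or_pos (j : ℕ) with h | h
    · simp [h]
    · obtain ⟨l, hl⟩ := Nat.exists_eq_add_of_le' h
      -- The power `μ ^ (j - 1)` cancels all rotations but one.
      have key : μ ^ l * ((starRingEnd ℂ) μ / (‖μ‖ : ℂ)) ^ (l + 1) =
          (starRingEnd ℂ) μ / (‖μ‖ : ℂ) * (‖μ‖ : ℂ) ^ l := by
        rw [pow_succ, ← mul_assoc, ← mul_pow, mul_conj_div_norm, mul_comm]
      push_cast
      rw [hl, Nat.add_sub_cancel]
      linear_combination ((l + 1 : ℕ) : ℂ) * ((w j : ℂ) / (weightEval w ‖μ‖ : ℂ)) * key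
  simp only [h1, ← Finset.mul_sum, ← Complex.ofReal_sum, weightDeriv, Finset.sum_div]

theorem eval_perturb (P : Coeffs n m) {w : Fin (m + 1) → ℝ} (hw : ∀ j, 0 ≤ w j) (hw0 : 0 < w 0)
    (μ : ℂ) (B : Matrix (Fin n) (Fin n) ℂ) : eval (perturb P w μ B) μ = eval P μ + B := by
  simp only [eval, perturb, smul_add, Finset.sum_add_distrib, smul_smul, ← Finset.sum_smul]
  rw [sum_pow_mul_share hw hw0, one_smul]

theorem evalDeriv_perturb (P : Coeffs n m) (w : Fin (m + 1) → ℝ) (μ : ℂ)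
    (B : Matrix (Fin n) (Fin n) ℂ) : evalDeriv (perturb P w μ B) μ = evalDeriv P μ +
      ((starRingEnd ℂ) μ / (‖μ‖ : ℂ) * (weightDeriv w ‖μ‖ / weightEval w ‖μ‖ : ℝ)) • B := by
  simp only [evalDeriv, perturb, smul_add, Finset.sum_add_distrib, smul_smul, ← Finset.sum_smul]
  rw [sum_deriv_mul_share]

theorem specNorm_smul (c : ℂ) (A : Matrix (Fin n) (Fin n) ℂ) :
    specNorm (c • A) = ‖c‖ * specNorm A := by
  rw [specNorm, map_smul, norm_smul, specNorm]

theorem specNorm_nonneg (A : Matrix (Fin n) (Fin n) ℂ) : 0 ≤ specNorm A := norm_nonneg _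

theorem norm_share_le {w : Fin (m + 1) → ℝ} (hw : ∀ j, 0 ≤ w j) (hw0 : 0 < w 0) (μ : ℂ)
    (j : Fin (m + 1)) : ‖share w μ j‖ ≤ w j / weightEval w ‖μ‖ := by
  have hW := weightEval_pos hw hw0 (norm_nonneg μ)
  rw [share, norm_mul, norm_pow, norm_div (w j : ℂ), Complex.norm_real, Complex.norm_real,
    Real.norm_of_nonneg (hw j), Real.norm_of_nonneg hW.le]
  exact mul_le_of_le_one_left (div_nonneg (hw j) hW.le)
    (pow_le_one₀ (norm_nonneg _) (norm_conj_div_norm_le μ))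

theorem perturb_mem_pertBall (P : Coeffs n m) {w : Fin (m + 1) → ℝ} (hw : ∀ j, 0 ≤ w j)
    (hw0 : 0 < w 0) {μ : ℂ} {B : Matrix (Fin n) (Fin n) ℂ} {δ : ℝ}
    (hB : specNorm B ≤ δ * weightEval w ‖μ‖) : perturb P w μ B ∈ pertBall P δ w := fun j => by
  have hW := weightEval_pos hw hw0 (norm_nonneg μ)
  rw [perturb, add_sub_cancel_left, specNorm_smul]
  calc _ ≤ w j / weightEval w ‖μ‖ * (δ * weightEval w ‖μ‖) :=
        mul_le_mul (norm_share_le hw hw0 μ j) hB (specNorm_nonneg B) (div_nonneg (hw j) hW.le)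
    _ = δ * w j := by field_simp

/-- The bound is attained at index `0`, whose share carries no rotation; this also covers `μ = 0`,
where the other shares vanish. -/
theorem perturb_mem_pertBoundary (P : Coeffs n m) {w : Fin (m + 1) → ℝ} (hw : ∀ j, 0 ≤ w j)
    (hw0 : 0 < w 0) {μ : ℂ} {B : Matrix (Fin n) (Fin n) ℂ} {δ : ℝ}
    (hB : specNorm B = δ * weightEval w ‖μ‖) : perturb P w μ B ∈ pertBoundary P δ w := by
  refine ⟨perturb_mem_pertBall P hw hw0 hB.le, 0, hw0, ?_⟩
  have hW := weightEval_pos hw hw0 (norm_nonneg μ)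
  rw [perturb, add_sub_cancel_left, specNorm_smul, hB, share]
  simp [abs_of_pos hw0, abs_of_pos hW]
  field_simp

theorem det_eq_zero_iff (A : Matrix (Fin n) (Fin n) ℂ) :
    A.det = 0 ↔ ∃ x, ‖x‖ = 1 ∧ Matrix.toEuclideanCLM (n := Fin n) (𝕜 := ℂ) A x = 0 := by
  rw [← Matrix.exists_mulVec_eq_zero_iff]
  constructor
  · rintro ⟨y, hy, h⟩
    have hy' : toLp 2 y ≠ 0 := by simpa using hy
    refine ⟨((‖toLp 2 y‖⁻¹ : ℝ) : ℂ) • toLp 2 y, ?_, ?_⟩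
    · rw [norm_smul, Complex.norm_real, norm_inv, norm_norm, inv_mul_cancel₀ (norm_ne_zero_iff.2 hy')]
    · rw [map_smul, Matrix.toEuclideanCLM_toLp, h]
      simp
  · rintro ⟨x, hx, h⟩
    refine ⟨ofLp x, fun h0 => ?_, congrArg ofLp h⟩
    have : x = 0 := by simpa using h0
    simp [this] at hx

/-- One direction is the triangle inequality. For the other, the rank-one change `-(P(z)x)x^*` has
norm `‖P(z)x‖`, kills `x`, and is distributed over the coefficients by `perturb`. -/
theorem mem_pseudospectrum_iff (P : Coeffs n m) {w : Fin (m + 1) → ℝ} (hw : ∀ j, 0 ≤ w j)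
    (hw0 : 0 < w 0) {δ : ℝ} {z : ℂ} : z ∈ pseudospectrum P w δ ↔
      ∃ x, ‖x‖ = 1 ∧ ‖evalOp P z x‖ ≤ δ * weightEval w ‖z‖ := by
  constructor
  · rintro ⟨Q, hQ, hdet⟩
    obtain ⟨x, hx, hQx⟩ := (det_eq_zero_iff _).1 hdet
    refine ⟨x, hx, ?_⟩
    have h1 : evalOp P z x = -((∑ j : Fin (m + 1), z ^ (j : ℕ) •
        Matrix.toEuclideanCLM (n := Fin n) (𝕜 := ℂ) (Q j - P j)) x) := by
      change evalOp Q z x = 0 at hQx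
      have : (∑ j : Fin (m + 1), z ^ (j : ℕ) •
          Matrix.toEuclideanCLM (n := Fin n) (𝕜 := ℂ) (Q j - P j)) = evalOp Q z - evalOp P z := by
        simp [evalOp_eq_sum, smul_sub]
      rw [this, sub_apply, hQx]
      simp
    rw [h1, norm_neg]
    refine (ContinuousLinearMap.le_opNorm _ x).trans ?_
    rw [hx, mul_one, weightEval, Finset.mul_sum]
    refine (norm_sum_le _ _).trans (Finset.sum_le_sum fun j _ => ?_)
    rw [norm_smul, norm_pow]
    calc _ ≤ ‖z‖ ^ (j : ℕ) * (δ * w j) := by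
          have := hQ j
          rw [specNorm] at this
          gcongr
      _ = _ := by ring
  · rintro ⟨x, hx, hle⟩
    set B := (Matrix.toEuclideanCLM (n := Fin n) (𝕜 := ℂ)).symm
      (-((innerSL ℂ x).smulRight (evalOp P z x))) with hB
    have hBop : Matrix.toEuclideanCLM (n := Fin n) (𝕜 := ℂ) B =
        -((innerSL ℂ x).smulRight (evalOp P z x)) := by
      rw [hB, StarAlgEquiv.apply_symm_apply]
    refine ⟨perturb P w z B, perturb_mem_pertBall P hw hw0 ?_, ?_⟩
    · rw [specNorm, hBop, norm_neg, ContinuousLinearMap.norm_smulRight_apply, innerSL_apply_norm,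
        hx, one_mul]
      exact hle
    · rw [det_eq_zero_iff]
      refine ⟨x, hx, ?_⟩
      rw [eval_perturb P hw hw0, map_add, hBop, add_apply]
      simp [inner_self_eq_norm_sq_to_K, hx, evalOp]

/-- An identically vanishing determinant would put every point of the plane into the pseudospectrum.
-/
theorem detPoly_ne_zero {P Q : Coeffs n m} {w : Fin (m + 1) → ℝ} {ε : ℝ}
    (hne : pseudospectrum P w ε ≠ Set.univ) (hQ : Q ∈ pertBall P ε w) : detPoly Q ≠ 0 := by
  intro h
  refine hne (Set.eq_univ_of_forall fun z => ⟨Q, hQ, ?_⟩)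
  rw [← eval_detPoly, h, Polynomial.eval_zero]

/-- The square of the bound `ε w(|z|)`. -/
def boundSq (w : Fin (m + 1) → ℝ) (ε : ℝ) (z : ℂ) : ℝ := (ε * weightEval w ‖z‖) ^ 2

theorem continuous_boundSq (w : Fin (m + 1) → ℝ) (ε : ℝ) : Continuous (boundSq w ε) :=
  (continuous_const.mul ((continuous_weightEval w).comp continuous_norm)).pow 2

theorem exists_lt_subset_pseudospectrum (P : Coeffs n m) {w : Fin (m + 1) → ℝ} (hw : ∀ j, 0 ≤ w j)
    (hw0 : 0 < w 0) {ε : ℝ} (hε : 0 < ε) {K : Set ℂ} (hK : IsCompact K)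
    (hKS : K ⊆ strictSublevel (evalOp P) (boundSq w ε)) :
    ∃ δ' < ε, ∀ δ, δ' ≤ δ → K ⊆ pseudospectrum P w δ := by
  refine hK.induction_on (p := fun s => ∃ δ' < ε, ∀ δ, δ' ≤ δ → s ⊆ pseudospectrum P w δ)
    ⟨ε - 1, by linarith, fun _ _ => Set.empty_subset _⟩ ?_ ?_ ?_
  · rintro s t hst ⟨δ', h1, h2⟩
    exact ⟨δ', h1, fun δ hδ => hst.trans (h2 δ hδ)⟩
  · rintro s t ⟨δ₁, h1, h2⟩ ⟨δ₂, h3, h4⟩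
    exact ⟨max δ₁ δ₂, max_lt h1 h3, fun δ hδ => Set.union_subset
      (h2 δ ((le_max_left _ _).trans hδ)) (h4 δ ((le_max_right _ _).trans hδ))⟩
  · intro z hz
    obtain ⟨x, hx, hlt⟩ := hKS hz
    have hW := weightEval_pos hw hw0 (norm_nonneg z)
    have hlt' : ‖evalOp P z x‖ < ε * weightEval w ‖z‖ := lt_of_pow_lt_pow_left₀ 2 (by positivity) hlt
    -- Leaving room below `ε` makes the inequality at level `δ'` strict, hence stable near `z`;
    -- compactness then needs only finitely many levels.
    obtain ⟨δ', h1, h2⟩ := exists_between ((div_lt_iff₀ hW).2 hlt')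
    rw [div_lt_iff₀ hW] at h1
    have h3 : ∀ᶠ p in 𝓝 z, ‖evalOp P p x‖ < δ' * weightEval w ‖p‖ :=
      (((continuous_evalOp P).clm_apply continuous_const).norm.continuousAt).eventually_lt
        (continuous_const.mul ((continuous_weightEval w).comp continuous_norm)).continuousAt h1
    refine ⟨_, mem_nhdsWithin_of_mem_nhds h3, δ', h2, fun δ hδ p hp => ?_⟩
    refine (mem_pseudospectrum_iff P hw hw0).2 ⟨x, hx, (le_of_lt hp).trans ?_⟩
    exact mul_le_mul_of_nonneg_right hδ (weightEval_pos hw hw0 (norm_nonneg p)).le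

theorem pseudospectrum_subset_strictSublevel (P : Coeffs n m) {w : Fin (m + 1) → ℝ}
    (hw : ∀ j, 0 ≤ w j) (hw0 : 0 < w 0) {δ ε : ℝ} (hδ : δ < ε) :
    pseudospectrum P w δ ⊆ strictSublevel (evalOp P) (boundSq w ε) := by
  intro z hz
  obtain ⟨x, hx, hle⟩ := (mem_pseudospectrum_iff P hw hw0).1 hz
  refine ⟨x, hx, pow_lt_pow_left₀ (hle.trans_lt ?_) (norm_nonneg _) two_ne_zero⟩
  exact mul_lt_mul_of_pos_right hδ (weightEval_pos hw hw0 (norm_nonneg z))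

/-! ### From meeting components to `NotLocallyJoined` -/

theorem GrowsTo.exists_mem {Λ : ℝ → Set ℂ} {δ₀ ε : ℝ} {C : ℝ → Set ℂ} {G : Set ℂ}
    (h : GrowsTo Λ δ₀ ε C G) {μ : ℂ} (hμ : μ ∈ G) {U : Set ℂ} (hU : U ∈ 𝓝 μ) :
    ∃ p ∈ U, ∃ δ ∈ Set.Ioo δ₀ ε, p ∈ C δ := by
  rw [h.2.2] at hμ
  obtain ⟨p, hpU, hp⟩ := mem_closure_iff_nhds.1 hμ U hU
  simp only [Set.mem_iUnion] at hp
  obtain ⟨δ, hδ, hp⟩ := hp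
  exact ⟨p, hpU, δ, hδ, hp⟩

theorem IsComponentOf.eq_connectedComponentIn {C S : Set ℂ} (h : IsComponentOf C S) {p : ℂ}
    (hp : p ∈ C) : C = connectedComponentIn S p := by
  obtain ⟨z, -, rfl⟩ := h
  exact connectedComponentIn_eq hp

theorem IsComponentOf.subset {C S : Set ℂ} (h : IsComponentOf C S) : C ⊆ S := by
  obtain ⟨z, -, rfl⟩ := h
  exact connectedComponentIn_subset S z

theorem ComponentsMeetAt.notLocallyJoined {P : Coeffs n m} {w : Fin (m + 1) → ℝ}
    (hw : ∀ j, 0 ≤ w j) (hw0 : 0 < w 0) {ε : ℝ} (hε : 0 < ε) {G₁ G₂ : Set ℂ} {μ : ℂ}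
    (h : ComponentsMeetAt (pseudospectrum P w) ε G₁ G₂ μ) :
    NotLocallyJoined (strictSublevel (evalOp P) (boundSq w ε)) μ := by
  obtain ⟨δ₀, -, -, C₁, C₂, h₁, h₂, hne, hμ⟩ := h
  intro U hU
  obtain ⟨p₁, hpU₁, δ₁, hδ₁, hp₁⟩ := h₁.exists_mem hμ.1 hU
  obtain ⟨p₂, hpU₂, δ₂, hδ₂, hp₂⟩ := h₂.exists_mem hμ.2 hU
  refine ⟨p₁, ⟨hpU₁, pseudospectrum_subset_strictSublevel P hw hw0 hδ₁.2
      ((h₁.1 δ₁ hδ₁).subset hp₁)⟩, p₂, ⟨hpU₂, pseudospectrum_subset_strictSublevel P hw hw0 hδ₂.2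
      ((h₂.1 δ₂ hδ₂).subset hp₂)⟩, fun K hKS hK hKc hp₁K hp₂K => ?_⟩
  obtain ⟨δ', hδ', hsub⟩ := exists_lt_subset_pseudospectrum P hw hw0 hε hK hKS
  -- At this level the pseudospectrum contains `K`, and both points have entered their components,
  -- so `K` would make the components equal.
  set δ := max δ' (max δ₁ δ₂) with hδdef
  have hδ : δ ∈ Set.Ioo δ₀ ε :=
    ⟨hδ₁.1.trans_le ((le_max_left _ _).trans (le_max_right _ _)),
      max_lt hδ' (max_lt hδ₁.2 hδ₂.2)⟩
  have hq₁ : p₁ ∈ C₁ δ := h₁.2.1 hδ₁ hδ ((le_max_left _ _).trans (le_max_right _ _)) hp₁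
  have hq₂ : p₂ ∈ C₂ δ := h₂.2.1 hδ₂ hδ ((le_max_right _ _).trans (le_max_right _ _)) hp₂
  have hmem := hKc.subset_connectedComponentIn hp₁K (hsub δ (le_max_left _ _)) hp₂K
  refine hne δ hδ ?_
  rw [(h₁.1 δ hδ).eq_connectedComponentIn hq₁, (h₂.1 δ hδ).eq_connectedComponentIn hq₂]
  exact connectedComponentIn_eq hmem

end Perturbation

open Filter Topology WithLp

/-! ### First-order lower bounds for `(ε w(|z|))²` -/

section Dini

theorem HasStrictFDerivAt.eventually_add_mul_le {q : ℂ → ℝ} {q' : ℂ →L[ℝ] ℝ} {μ : ℂ}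
    (hq : HasStrictFDerivAt q q' μ) (d : ℂ) {η : ℝ} (hη : 0 < η) :
    ∀ᶠ y : ℂ × ℝ in 𝓝 (μ, 0), 0 ≤ y.2 → q y.1 + y.2 * (q' d - η) ≤ q (y.1 + y.2 * d) := by
  have h3 := hq.isLittleO.def (c := η / (‖d‖ + 1)) (by positivity)
  have htend : Tendsto (fun y : ℂ × ℝ => ((y.1 + y.2 * d, y.1) : ℂ × ℂ)) (𝓝 (μ, 0))
      (𝓝 (μ, μ)) := by
    have : Continuous (fun y : ℂ × ℝ => ((y.1 + y.2 * d, y.1) : ℂ × ℂ)) := by fun_prop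
    simpa using this.tendsto (μ, 0)
  filter_upwards [htend.eventually h3] with y hy ht
  have h4 := (neg_le_abs _).trans hy
  have hsm : (y.2 : ℂ) * d = y.2 • d := by simp
  simp only [add_sub_cancel_left, hsm, map_smul, norm_smul, smul_eq_mul,
    Real.norm_of_nonneg ht] at h4
  have h5 : η / (‖d‖ + 1) * (y.2 * ‖d‖) ≤ y.2 * η := by
    rw [div_mul_eq_mul_div, div_le_iff₀ (by positivity)]
    nlinarith [mul_nonneg ht hη.le]
  rw [hsm]
  linarith

/-- The modulus has no derivative at `0` but is `1`-Lipschitz, so with `ψ' ≥ 0` the loss rate is at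
most `ψ' * ‖d‖`. -/
theorem HasStrictDerivAt.eventually_norm_add_mul_le {ψ : ℝ → ℝ} {ψ' : ℝ}
    (hψ : HasStrictDerivAt ψ ψ' 0) (hψ' : 0 ≤ ψ') (d : ℂ) {η : ℝ} (hη : 0 < η) :
    ∀ᶠ y : ℂ × ℝ in 𝓝 (0, 0), 0 ≤ y.2 →
      ψ ‖y.1‖ + y.2 * (-(ψ' * ‖d‖) - η) ≤ ψ ‖y.1 + y.2 * d‖ := by
  have h3 := hψ.hasStrictFDerivAt.isLittleO.def (c := η / (‖d‖ + 1)) (by positivity)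
  have htend : Tendsto (fun y : ℂ × ℝ => ((‖y.1 + y.2 * d‖, ‖y.1‖) : ℝ × ℝ)) (𝓝 (0, 0))
      (𝓝 (0, 0)) := by
    have : Continuous (fun y : ℂ × ℝ => ((‖y.1 + y.2 * d‖, ‖y.1‖) : ℝ × ℝ)) := by fun_prop
    simpa using this.tendsto (0, 0)
  filter_upwards [htend.eventually h3] with y hy ht
  have h4 := (neg_le_abs _).trans hy
  have h6 : |‖y.1 + y.2 * d‖ - ‖y.1‖| ≤ y.2 * ‖d‖ := by
    refine (abs_norm_sub_norm_le _ _).trans ?_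
    rw [add_sub_cancel_left, norm_mul, Complex.norm_real, Real.norm_of_nonneg ht]
  have h5 : η / (‖d‖ + 1) * (y.2 * ‖d‖) ≤ y.2 * η := by
    rw [div_mul_eq_mul_div, div_le_iff₀ (by positivity)]
    nlinarith [mul_nonneg ht hη.le]
  have h7 : η / (‖d‖ + 1) * |‖y.1 + y.2 * d‖ - ‖y.1‖| ≤ η / (‖d‖ + 1) * (y.2 * ‖d‖) := by
    gcongr
  have h8 : -(y.2 * ‖d‖) * ψ' ≤ (‖y.1 + y.2 * d‖ - ‖y.1‖) * ψ' :=
    mul_le_mul_of_nonneg_right (neg_le_of_abs_le h6) hψ'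
  simp only [ContinuousLinearMap.toSpanSingleton_apply, smul_eq_mul, Real.norm_eq_abs] at h4
  linarith

variable {m : ℕ}

theorem boundSq_dini (w : Fin (m + 1) → ℝ) (ε : ℝ) {μ : ℂ} (hμ : μ ≠ 0) (d : ℂ) {η : ℝ}
    (hη : 0 < η) : ∀ᶠ y : ℂ × ℝ in 𝓝 (μ, 0), 0 ≤ y.2 →
      boundSq w ε y.1 + y.2 * (2 * (ε * weightEval w ‖μ‖) * (ε * weightDeriv w ‖μ‖) *
        (d * ((starRingEnd ℂ) μ / (‖μ‖ : ℂ))).re - η) ≤ boundSq w ε (y.1 + y.2 * d) := by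
  have hμ' : ‖μ‖ ≠ 0 := norm_ne_zero_iff.2 hμ
  -- Away from `0` the modulus is differentiated as the square root of the smooth function `‖z‖ ^
  -- 2`.
  have h1 : HasStrictFDerivAt (fun z : ℂ => √(‖z‖ ^ 2)) _ μ :=
    (hasStrictFDerivAt_norm_sq μ).sqrt (by positivity)
  simp only [Real.sqrt_sq (norm_nonneg _)] at h1
  have h2 := (((hasStrictDerivAt_weightEval w ‖μ‖).const_mul ε).pow 2).comp_hasStrictFDerivAt μ h1
  have h3 := HasStrictFDerivAt.eventually_add_mul_le h2 d hη
  convert! h3 using 6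
  simp [div_eq_mul_inv, real_inner_eq_re_inner, ← Complex.ofReal_inv, ← mul_assoc]
  field_simp

theorem boundSq_dini_zero {w : Fin (m + 1) → ℝ} (hw : ∀ j, 0 ≤ w j) (hw0 : 0 < w 0) {ε : ℝ}
    (hε : 0 < ε) (d : ℂ) {η : ℝ} (hη : 0 < η) : ∀ᶠ y : ℂ × ℝ in 𝓝 (0, 0), 0 ≤ y.2 →
      boundSq w ε y.1 + y.2 * (-(2 * (ε * weightEval w 0) * (ε * weightDeriv w 0) * ‖d‖) - η) ≤
        boundSq w ε (y.1 + y.2 * d) := by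
  have h := ((hasStrictDerivAt_weightEval w 0).const_mul ε).pow 2
  have h1 := weightEval_pos hw hw0 le_rfl
  have h2 := weightDeriv_nonneg hw le_rfl
  simpa [boundSq] using HasStrictDerivAt.eventually_norm_add_mul_le h (by positivity) d hη

end Dini

/-! ### First-order conditions at a meeting point -/

section Critical

variable {n m : ℕ} {P : Coeffs n m} {w : Fin (m + 1) → ℝ} {ε : ℝ} {μ : ℂ}
  {U V : Matrix (Fin n) (Fin n) ℂ}

theorem nonempty_of_notLocallyJoined
    (h : NotLocallyJoined (strictSublevel (evalOp P) (boundSq w ε)) μ) : n ≠ 0 := by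
  rintro rfl
  obtain ⟨p, ⟨-, x, hx, -⟩, -⟩ := h Set.univ Filter.univ_mem
  rw [Subsingleton.elim x 0] at hx
  simp at hx

theorem minSingVal_eq_of_notLocallyJoined (hw : ∀ j, 0 ≤ w j) (hw0 : 0 < w 0) (hε : 0 < ε)
    (h : NotLocallyJoined (strictSublevel (evalOp P) (boundSq w ε)) μ)
    (hUV : AreSingularVectors (eval P μ) U V) :
    minSingVal (eval P μ) = ε * weightEval w ‖μ‖ := by
  have hW := weightEval_pos hw hw0 (norm_nonneg μ)
  refine le_antisymm ?_ ?_
  · obtain ⟨x, hx, hle⟩ := exists_norm_sq_le_of_notLocallyJoined (continuous_evalOp P)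
      (continuous_boundSq w ε) h
    exact le_of_sq_le_sq ((hUV.minSingVal_sq_le hx).trans hle) (by positivity)
  · obtain ⟨k, hk⟩ := exists_singVal_eq_minSingVal (nonempty_of_notLocallyJoined h) (eval P μ)
    have := le_norm_sq_of_notLocallyJoined (continuous_evalOp P) (continuous_boundSq w ε) h
      (norm_toLp_col hUV.2.1 k)
    rw [evalOp, hUV.norm_apply_col, hk] at this
    exact le_of_sq_le_sq this (minSingVal_nonneg _)

/-- `P(μ)` is invertible: a unit kernel vector would violate the positive lower bound for
`‖P(μ)x‖²`. -/
theorem exists_areSingularVectors_of_notLocallyJoined (hw : ∀ j, 0 ≤ w j) (hw0 : 0 < w 0)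
    (hε : 0 < ε) (h : NotLocallyJoined (strictSublevel (evalOp P) (boundSq w ε)) μ) :
    ∃ U V, AreSingularVectors (eval P μ) U V := by
  refine exists_areSingularVectors fun x hx => ?_
  by_contra hx0
  have hdet : (eval P μ).det = 0 :=
    Matrix.exists_mulVec_eq_zero_iff.1 ⟨ofLp x, by simpa using hx0, congrArg ofLp hx⟩
  obtain ⟨y, hy, hy0⟩ := (det_eq_zero_iff _).1 hdet
  have h1 := le_norm_sq_of_notLocallyJoined (continuous_evalOp P) (continuous_boundSq w ε) h hy
  have hW := weightEval_pos hw hw0 (norm_nonneg μ)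
  rw [evalOp, hy0, norm_zero, boundSq] at h1
  have : 0 < (ε * weightEval w ‖μ‖) ^ 2 := by positivity
  rw [zero_pow two_ne_zero] at h1
  exact this.not_ge h1

theorem inner_col_apply_col (A : Matrix (Fin n) (Fin n) ℂ) (k : Fin n) :
    inner ℂ (toLp 2 (U.col k)) (Matrix.toEuclideanCLM (n := Fin n) (𝕜 := ℂ) A (toLp 2 (V.col k))) =
      (Uᴴ * A * V) k k := by
  rw [Matrix.toEuclideanCLM_toLp, EuclideanSpace.inner_toLp_toLp, Matrix.mul_assoc,
    Matrix.mul_apply, dotProduct_comm]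
  simp [dotProduct, Matrix.mul_apply, Matrix.mulVec]

/-- No direction decreases `s_n(P(z)) - ε w(|z|)` to first order at a meeting point where `s_n` is
simple. -/
theorem dini_le_re_of_simple (hw : ∀ j, 0 ≤ w j) (hw0 : 0 < w 0) (hε : 0 < ε)
    (h : NotLocallyJoined (strictSublevel (evalOp P) (boundSq w ε)) μ)
    (hUV : AreSingularVectors (eval P μ) U V) {k : Fin n}
    (hk : ∀ j, j ≠ k → minSingVal (eval P μ) < singVal (eval P μ) j)
    (hk' : singVal (eval P μ) k = minSingVal (eval P μ)) {d : ℂ} {β : ℝ}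
    (hdini : ∀ η > 0, ∀ᶠ y : ℂ × ℝ in 𝓝 (μ, 0), 0 ≤ y.2 → boundSq w ε y.1 +
      y.2 * (2 * (ε * weightEval w ‖μ‖) * β - η) ≤ boundSq w ε (y.1 + y.2 * d)) :
    β ≤ (d * (Uᴴ * evalDeriv P μ * V) k k).re := by
  have hs := minSingVal_eq_of_notLocallyJoined hw hw0 hε h hUV
  have hW := weightEval_pos hw hw0 (norm_nonneg μ)
  have h1 := dini_le_of_notLocallyJoined (hasStrictDerivAt_evalOp P μ) (continuous_evalOp P)
    (continuous_boundSq w ε) hdini (norm_toLp_col hUV.2.1 k)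
    (by rw [evalOp, hUV.norm_apply_col, hk', hs, boundSq])
    (fun x hx hle => hUV.exists_phase hk hx (by rwa [hs])) h
  rw [evalOp, hUV.apply_col, hk', hs, inner_smul_left, inner_col_apply_col, Complex.conj_ofReal,
    mul_left_comm d, Complex.re_ofReal_mul, ← mul_assoc] at h1
  have h2 : 0 < 2 * (ε * weightEval w ‖μ‖) := by positivity
  exact le_of_mul_le_mul_left (by linarith) h2

theorem entry_eq_of_simple (hw : ∀ j, 0 ≤ w j) (hw0 : 0 < w 0) (hε : 0 < ε)
    (h : NotLocallyJoined (strictSublevel (evalOp P) (boundSq w ε)) μ)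
    (hUV : AreSingularVectors (eval P μ) U V) {k : Fin n}
    (hk : ∀ j, j ≠ k → minSingVal (eval P μ) < singVal (eval P μ) j)
    (hk' : singVal (eval P μ) k = minSingVal (eval P μ)) (hμ : μ ≠ 0) :
    (Uᴴ * evalDeriv P μ * V) k k =
      ε * weightDeriv w ‖μ‖ * ((starRingEnd ℂ) μ / (‖μ‖ : ℂ)) := by
  set a := (Uᴴ * evalDeriv P μ * V) k k with ha
  set b := (ε * weightDeriv w ‖μ‖ * ((starRingEnd ℂ) μ / (‖μ‖ : ℂ)) : ℂ) with hb
  -- In this direction the first-order change `Re (d * (a - b))` is `-‖a - b‖²`, and it must not be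
  -- negative.
  have h1 := dini_le_re_of_simple hw hw0 hε h hUV hk hk' (d := -(starRingEnd ℂ) (a - b))
    (β := ε * weightDeriv w ‖μ‖ *
      (-(starRingEnd ℂ) (a - b) * ((starRingEnd ℂ) μ / (‖μ‖ : ℂ))).re)
    (fun η hη => by simpa only [mul_assoc] using boundSq_dini w ε hμ _ hη)
  rw [← ha, ← Complex.re_ofReal_mul] at h1
  have h2 : ((ε * weightDeriv w ‖μ‖ : ℝ) : ℂ) *
      (-(starRingEnd ℂ) (a - b) * ((starRingEnd ℂ) μ / (‖μ‖ : ℂ))) =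
      -(starRingEnd ℂ) (a - b) * b := by
    rw [hb]; push_cast; ring
  rw [h2, ← sub_nonneg, ← Complex.sub_re, ← mul_sub, neg_mul, Complex.conj_mul', Complex.neg_re,
    ← Complex.ofReal_pow, Complex.ofReal_re] at h1
  have h3 : ‖a - b‖ ^ 2 = 0 := le_antisymm (by linarith) (by positivity)
  exact sub_eq_zero.1 (norm_eq_zero.1 (pow_eq_zero_iff two_ne_zero |>.1 h3))

theorem norm_entry_le_of_simple (hw : ∀ j, 0 ≤ w j) (hw0 : 0 < w 0) (hε : 0 < ε)
    (h : NotLocallyJoined (strictSublevel (evalOp P) (boundSq w ε)) 0)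
    (hUV : AreSingularVectors (eval P 0) U V) {k : Fin n}
    (hk : ∀ j, j ≠ k → minSingVal (eval P 0) < singVal (eval P 0) j)
    (hk' : singVal (eval P 0) k = minSingVal (eval P 0)) :
    ‖(Uᴴ * evalDeriv P 0 * V) k k‖ ≤ ε * weightDeriv w 0 := by
  set a := (Uᴴ * evalDeriv P 0 * V) k k with ha
  -- The steepest descent direction of `Re (d * a)` yields `‖a‖² ≤ ε w'(0) ‖a‖`.
  have h1 := dini_le_re_of_simple hw hw0 hε h hUV hk hk' (d := -(starRingEnd ℂ) a)
    (β := -(ε * weightDeriv w 0 * ‖a‖)) (fun η hη => by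
      have := boundSq_dini_zero hw hw0 hε (-(starRingEnd ℂ) a) hη
      rw [norm_neg, RCLike.norm_conj] at this
      simpa only [norm_zero, mul_neg, mul_assoc] using this)
  rw [← ha, neg_mul, Complex.conj_mul', Complex.neg_re, ← Complex.ofReal_pow,
    Complex.ofReal_re] at h1
  by_contra! hcon
  have h2 := weightDeriv_nonneg hw le_rfl
  have h3 : 0 ≤ ε * weightDeriv w 0 := by positivity
  nlinarith

end Critical

/-! ### Multiplicities of the perturbed polynomials -/

section Conclusion

variable {n m : ℕ} {P : Coeffs n m} {w : Fin (m + 1) → ℝ} {ε : ℝ} {μ : ℂ}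
  {U V : Matrix (Fin n) (Fin n) ℂ}

open scoped Matrix.Norms.L2Operator in
theorem specNorm_mul_diagonal_mul (hU : U ∈ Matrix.unitaryGroup (Fin n) ℂ)
    (hV : V ∈ Matrix.unitaryGroup (Fin n) ℂ) (b : Fin n → ℂ) :
    specNorm (U * Matrix.diagonal b * Vᴴ) = ‖b‖ := by
  rw [specNorm, Matrix.l2_opNorm_toEuclideanCLM,
    CStarRing.norm_mul_mem_unitary _ (conjTranspose_mem_unitaryGroup hV),
    CStarRing.norm_mem_unitary_mul _ hU, Matrix.l2_opNorm_diagonal]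

theorem conjTranspose_mul_mul_mul (hU : U ∈ Matrix.unitaryGroup (Fin n) ℂ)
    (hV : V ∈ Matrix.unitaryGroup (Fin n) ℂ) (D : Matrix (Fin n) (Fin n) ℂ) :
    Uᴴ * (U * D * Vᴴ) * V = D := by
  rw [Matrix.mul_assoc U, ← Matrix.mul_assoc Uᴴ, star_mul_self_of_mem_unitaryGroup hU,
    Matrix.one_mul, Matrix.mul_assoc, star_mul_self_of_mem_unitaryGroup hV, Matrix.mul_one]

/-- Weights for the singular vectors that are `1` on those belonging to `s_n`. -/
structure IsMinWeight (A : Matrix (Fin n) (Fin n) ℂ) (b : Fin n → ℝ) : Prop where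
  nonneg : ∀ j, 0 ≤ b j
  le_one : ∀ j, b j ≤ 1
  eq_one : ∀ j, singVal A j = minSingVal A → b j = 1

/-- `∑ j, b_j u_j v_j^*`. -/
def weightedZ (U V : Matrix (Fin n) (Fin n) ℂ) (b : Fin n → ℝ) : Matrix (Fin n) (Fin n) ℂ :=
  U * Matrix.diagonal (fun j => (b j : ℂ)) * Vᴴ

theorem IsMinWeight.norm_eq_one {A : Matrix (Fin n) (Fin n) ℂ} {b : Fin n → ℝ}
    (hb : IsMinWeight A b) (hn : n ≠ 0) : ‖fun j => (b j : ℂ)‖ = 1 := by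
  obtain ⟨k, hk⟩ := exists_singVal_eq_minSingVal hn A
  refine le_antisymm ((pi_norm_le_iff_of_nonneg zero_le_one).2 fun j => ?_) ?_
  · rw [Complex.norm_real, Real.norm_of_nonneg (hb.nonneg j)]
    exact hb.le_one j
  · have := norm_le_pi_norm (fun j => (b j : ℂ)) k
    rwa [hb.eq_one k hk, Complex.ofReal_one, norm_one] at this

theorem specNorm_neg_smul_weightedZ (hUV : AreSingularVectors (eval P μ) U V) {b : Fin n → ℝ}
    (hb : IsMinWeight (eval P μ) b) (hn : n ≠ 0) :
    specNorm (-((minSingVal (eval P μ) : ℂ) • weightedZ U V b)) = minSingVal (eval P μ) := by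
  rw [← neg_smul, specNorm_smul, weightedZ, specNorm_mul_diagonal_mul hUV.1 hUV.2.1,
    hb.norm_eq_one hn, mul_one, norm_neg, Complex.norm_real,
    Real.norm_of_nonneg (minSingVal_nonneg _)]

theorem pertAt_mem_pertBoundary (hw : ∀ j, 0 ≤ w j) (hw0 : 0 < w 0) (hε : 0 < ε)
    (h : NotLocallyJoined (strictSublevel (evalOp P) (boundSq w ε)) μ)
    (hUV : AreSingularVectors (eval P μ) U V) {b : Fin n → ℝ} (hb : IsMinWeight (eval P μ) b) :
    pertAt P w μ (weightedZ U V b) ∈ pertBoundary P ε w :=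
  perturb_mem_pertBoundary P hw hw0 ((specNorm_neg_smul_weightedZ hUV hb
    (nonempty_of_notLocallyJoined h)).trans (minSingVal_eq_of_notLocallyJoined hw hw0 hε h hUV))

theorem eval_add_weightedZ (hUV : AreSingularVectors (eval P μ) U V) (b : Fin n → ℝ) :
    eval P μ + -((minSingVal (eval P μ) : ℂ) • weightedZ U V b) = U * Matrix.diagonal
      (fun j => ((singVal (eval P μ) j - minSingVal (eval P μ) * b j : ℝ) : ℂ)) * Vᴴ := by
  conv_lhs => enter [1]; rw [hUV.eq_mul]
  rw [weightedZ, ← sub_eq_add_neg, ← Matrix.smul_mul, ← Matrix.mul_smul, ← Matrix.sub_mul,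
    ← Matrix.mul_sub, ← Matrix.diagonal_smul, Matrix.diagonal_sub]
  congr 3
  ext j
  simp

theorem eval_pertAt (hw : ∀ j, 0 ≤ w j) (hw0 : 0 < w 0)
    (hUV : AreSingularVectors (eval P μ) U V) (b : Fin n → ℝ) :
    eval (pertAt P w μ (weightedZ U V b)) μ = U * Matrix.diagonal
      (fun j => ((singVal (eval P μ) j - minSingVal (eval P μ) * b j : ℝ) : ℂ)) * Vᴴ :=
  (eval_perturb P hw hw0 μ _).trans (eval_add_weightedZ hUV b)

/-- Since `b j ≤ 1`, the difference is at least `s_j - s_n ≥ 0`; no further diagonal entries are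
annihilated. -/
theorem IsMinWeight.sub_eq_zero_iff {A : Matrix (Fin n) (Fin n) ℂ} {b : Fin n → ℝ}
    (hb : IsMinWeight A b) (j : Fin n) :
    ((singVal A j - minSingVal A * b j : ℝ) : ℂ) = 0 ↔ singVal A j = minSingVal A := by
  rw [Complex.ofReal_eq_zero]
  constructor
  · intro h
    have h1 := minSingVal_le A j
    have h2 := mul_le_of_le_one_right (minSingVal_nonneg A) (hb.le_one j)
    linarith
  · intro h
    rw [hb.eq_one j h, h, mul_one, sub_self]

theorem entry_pertAt (hUV : AreSingularVectors (eval P μ) U V) {b : Fin n → ℝ} {k : Fin n}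
    (hbk : b k = 1) : (Uᴴ * evalDeriv (pertAt P w μ (weightedZ U V b)) μ * V) k k =
      (Uᴴ * evalDeriv P μ * V) k k - (starRingEnd ℂ) μ / (‖μ‖ : ℂ) *
        (weightDeriv w ‖μ‖ / weightEval w ‖μ‖ : ℝ) * minSingVal (eval P μ) := by
  have h1 : evalDeriv (pertAt P w μ (weightedZ U V b)) μ = _ := evalDeriv_perturb P w μ _
  rw [h1, Matrix.mul_add, Matrix.add_mul, Matrix.add_apply, Matrix.mul_smul, Matrix.smul_mul,
    ← neg_smul, Matrix.mul_smul, Matrix.smul_mul, weightedZ,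
    conjTranspose_mul_mul_mul hUV.1 hUV.2.1]
  simp [hbk]
  ring

theorem exists_simple_or (hn : n ≠ 0) (A : Matrix (Fin n) (Fin n) ℂ) :
    ∃ k, singVal A k = minSingVal A ∧ ((∃ j, j ≠ k ∧ singVal A j = minSingVal A) ∨
      ∀ j, j ≠ k → minSingVal A < singVal A j) := by
  obtain ⟨k, hk⟩ := exists_singVal_eq_minSingVal hn A
  refine ⟨k, hk, or_iff_not_imp_left.2 fun h j hj => ?_⟩
  push Not at h
  exact (minSingVal_le A j).lt_of_ne' (h j hj)

/-- A multiple `s_n` gives two zeros on the diagonal. For a simple one, `s_n = ε w(|μ|)` turns the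
correction in `entry_pertAt` into `ε w'(|μ|) conj μ / |μ|`, the value forced by the first-order
condition. -/
theorem isMultipleEigenvalue_pertAt (hw : ∀ j, 0 ≤ w j) (hw0 : 0 < w 0) (hε : 0 < ε)
    (hne : pseudospectrum P w ε ≠ Set.univ)
    (h : NotLocallyJoined (strictSublevel (evalOp P) (boundSq w ε)) μ)
    (hUV : AreSingularVectors (eval P μ) U V) {b : Fin n → ℝ} (hb : IsMinWeight (eval P μ) b)
    (hμ : μ ≠ 0 ∨ μ = 0 ∧ IsConstWeight w) :
    IsMultipleEigenvalue (pertAt P w μ (weightedZ U V b)) μ := by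
  obtain ⟨k, hk, hor⟩ := exists_simple_or (nonempty_of_notLocallyJoined h) (eval P μ)
  refine two_le_algMult (detPoly_ne_zero hne (pertAt_mem_pertBoundary hw hw0 hε h hUV hb).1)
    hUV.1 hUV.2.1 (eval_pertAt hw hw0 hUV b) ((hb.sub_eq_zero_iff k).2 hk) ?_
  rcases hor with ⟨j, hjk, hj⟩ | hsimple
  · exact Or.inl ⟨j, hjk, (hb.sub_eq_zero_iff j).2 hj⟩
  · right
    rw [entry_pertAt hUV (hb.eq_one k hk), minSingVal_eq_of_notLocallyJoined hw hw0 hε h hUV]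
    rcases hμ with hμ | ⟨rfl, hconst⟩
    · rw [entry_eq_of_simple hw hw0 hε h hUV hsimple hk hμ]
      have hW : (weightEval w ‖μ‖ : ℂ) ≠ 0 := by
        exact_mod_cast (weightEval_pos hw hw0 (norm_nonneg μ)).ne'
      push_cast
      field_simp
      ring
    · have h1 := norm_entry_le_of_simple hw hw0 hε h hUV hsimple hk
      rw [hconst.weightDeriv_eq_zero, mul_zero] at h1
      rw [norm_le_zero_iff.1 h1]
      simp

/-- Up to unitary factors `Q(μ)` is diagonal with exactly one zero, so its rank is `n - 1`. -/
theorem geomMult_pertAt (hw : ∀ j, 0 ≤ w j) (hw0 : 0 < w 0)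
    (hUV : AreSingularVectors (eval P μ) U V) {b : Fin n → ℝ} (hb : IsMinWeight (eval P μ) b)
    (hs : MinSingValSimple (eval P μ)) :
    geomMult (pertAt P w μ (weightedZ U V b)) μ = 1 := by
  obtain ⟨k, hk, huniq⟩ := hs
  have hunit : ∀ {A B : Matrix (Fin n) (Fin n) ℂ}, A * B = 1 → IsUnit A.det := fun hAB =>
    IsUnit.of_mul_eq_one _ (by rw [← Matrix.det_mul, hAB, Matrix.det_one])
  have hrank := LinearMap.finrank_range_add_finrank_ker
    (Matrix.toLin' (eval (pertAt P w μ (weightedZ U V b)) μ))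
  have h1 : Module.finrank ℂ
      (LinearMap.range (Matrix.toLin' (eval (pertAt P w μ (weightedZ U V b)) μ))) = n - 1 := by
    change (eval (pertAt P w μ (weightedZ U V b)) μ).rank = n - 1
    rw [eval_pertAt hw hw0 hUV, Matrix.rank_mul_eq_left_of_isUnit_det _ _
      (hunit (star_mul_self_of_mem_unitaryGroup hUV.2.1)),
      Matrix.rank_mul_eq_right_of_isUnit_det _ _
      (hunit (mul_star_self_of_mem_unitaryGroup hUV.1)), Matrix.rank_diagonal]
    have h2 : ∀ j, ((singVal (eval P μ) j - minSingVal (eval P μ) * b j : ℝ) : ℂ) ≠ 0 ↔ j ≠ k :=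
      fun j => not_congr ((hb.sub_eq_zero_iff j).trans ⟨huniq j, fun h => h ▸ hk⟩)
    rw [Fintype.card_congr (Equiv.subtypeEquivRight h2)]
    simp
  rw [h1, Module.finrank_fin_fun] at hrank
  have := k.pos
  change geomMult _ _ = 1
  rw [geomMult]
  omega

theorem isMinWeight_one (A : Matrix (Fin n) (Fin n) ℂ) : IsMinWeight A fun _ => 1 :=
  ⟨fun _ => zero_le_one, fun _ => le_rfl, fun _ _ => rfl⟩

theorem Zhat_eq (U V : Matrix (Fin n) (Fin n) ℂ) : Zhat U V = weightedZ U V fun _ => 1 := by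
  simp [Zhat, weightedZ]

open Classical in
theorem isMinWeight_ite (A : Matrix (Fin n) (Fin n) ℂ) :
    IsMinWeight A fun j => if singVal A j = minSingVal A then 1 else 0 :=
  ⟨fun j => by split_ifs <;> simp, fun j => by split_ifs <;> simp, fun j hj => if_pos hj⟩

open Classical in
theorem Ztilde_eq (A U V : Matrix (Fin n) (Fin n) ℂ) :
    Ztilde A U V = weightedZ U V fun j => if singVal A j = minSingVal A then 1 else 0 := by
  ext a c
  simp only [Ztilde, weightedZ, Matrix.sum_apply]
  rw [Matrix.mul_apply]
  refine Finset.sum_congr rfl fun j _ => ?_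
  rw [Matrix.mul_diagonal]
  split_ifs <;> simp [Matrix.vecMulVec_apply]

/-! ### The meeting point `0` with a weight that need not be constant -/

theorem eval_zero (Q : Coeffs n m) : eval Q 0 = Q 0 := by
  rw [eval, Finset.sum_eq_single 0]
  · simp
  · intro j _ hj
    have : (j : ℕ) ≠ 0 := fun h => hj (Fin.ext h)
    simp [this]
  · simp

theorem evalDeriv_zero (Q : Coeffs n m) (hm : 1 < m + 1) : evalDeriv Q 0 = Q ⟨1, hm⟩ := by
  rw [evalDeriv, Finset.sum_eq_single ⟨1, hm⟩]
  · simp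
  · intro j _ hj
    have : (j : ℕ) ≠ 1 := fun h => hj (Fin.ext h)
    rcases Nat.eq_zero_or_pos (j : ℕ) with h0 | h0
    · simp [h0]
    · have : (j : ℕ) - 1 ≠ 0 := by omega
      simp [this]
  · simp

theorem weightDeriv_zero (w : Fin (m + 1) → ℝ) (hm : 1 < m + 1) :
    weightDeriv w 0 = w ⟨1, hm⟩ := by
  rw [weightDeriv, Finset.sum_eq_single ⟨1, hm⟩]
  · simp
  · intro j _ hj
    have : (j : ℕ) ≠ 1 := fun h => hj (Fin.ext h)
    rcases Nat.eq_zero_or_pos (j : ℕ) with h0 | h0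
    · simp [h0]
    · have : (j : ℕ) - 1 ≠ 0 := by omega
      simp [this]
  · simp

/-- At a meeting point `0` some perturbation on the boundary has the multiple eigenvalue `0`: if
`s_n` is simple, the coefficient of `λ` absorbs `u_n^* P'(0) v_n`. -/
theorem exists_isMultipleEigenvalue_zero (hw : ∀ j, 0 ≤ w j) (hw0 : 0 < w 0) (hε : 0 < ε)
    (hne : pseudospectrum P w ε ≠ Set.univ)
    (h : NotLocallyJoined (strictSublevel (evalOp P) (boundSq w ε)) 0) (hm : 1 < m + 1) :
    ∃ Q ∈ pertBoundary P ε w, IsMultipleEigenvalue Q 0 := by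
  obtain ⟨U, V, hUV⟩ := exists_areSingularVectors_of_notLocallyJoined hw hw0 hε h
  have hn := nonempty_of_notLocallyJoined h
  obtain ⟨k, hk, hor⟩ := exists_simple_or hn (eval P 0)
  have hb := isMinWeight_one (eval P 0)
  have hs := minSingVal_eq_of_notLocallyJoined hw hw0 hε h hUV
  have hs0 : ε * weightEval w ‖(0 : ℂ)‖ = ε * w 0 := by
    rw [norm_zero, weightEval, Finset.sum_eq_single 0]
    · simp
    · intro j _ hj
      have : (j : ℕ) ≠ 0 := fun h => hj (Fin.ext h)
      simp [this]
    · simp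
  -- `c` is the entry to be removed from the linear coefficient. It is `0` when `s_n` is multiple;
  -- otherwise the first-order bound at `0` makes it admissible, even if `w_1 = 0`.
  obtain ⟨c, hc, hc'⟩ : ∃ c : ℂ, ‖c‖ ≤ ε * w ⟨1, hm⟩ ∧
      ((∃ j, j ≠ k ∧ singVal (eval P 0) j = minSingVal (eval P 0)) ∨
        c = (Uᴴ * P ⟨1, hm⟩ * V) k k) := by
    rcases hor with hmult | hsimple
    · exact ⟨0, by simpa using mul_nonneg hε.le (hw _), Or.inl hmult⟩
    · refine ⟨_, ?_, Or.inr rfl⟩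
      rw [← weightDeriv_zero w hm, ← evalDeriv_zero P hm]
      exact norm_entry_le_of_simple hw hw0 hε h hUV hsimple hk
  have h10 : (⟨1, hm⟩ : Fin (m + 1)) ≠ 0 := fun h => by simpa using congrArg Fin.val h
  -- The two changes do not interfere: `Q(0)` sees only the constant coefficient and `Q'(0)` only
  -- the linear one.
  set Q : Coeffs n m := Function.update (Function.update P 0
    (P 0 + -((minSingVal (eval P 0) : ℂ) • weightedZ U V fun _ => 1))) ⟨1, hm⟩
    (P ⟨1, hm⟩ + -(U * Matrix.diagonal (Pi.single k c) * Vᴴ)) with hQ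
  have hQ1 : Q ⟨1, hm⟩ = P ⟨1, hm⟩ + -(U * Matrix.diagonal (Pi.single k c) * Vᴴ) := by
    rw [hQ, Function.update_self]
  have hQ0 : Q 0 = P 0 + -((minSingVal (eval P 0) : ℂ) • weightedZ U V fun _ => 1) := by
    rw [hQ, Function.update_of_ne h10.symm, Function.update_self]
  have hQ0' : specNorm (Q 0 - P 0) = ε * w 0 := by
    rw [hQ0, add_sub_cancel_left, specNorm_neg_smul_weightedZ hUV hb hn, hs, hs0]
  have hQball : Q ∈ pertBall P ε w := by
    intro j
    rcases eq_or_ne j ⟨1, hm⟩ with rfl | hj1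
    · rw [hQ1, add_sub_cancel_left, ← neg_one_smul ℂ, specNorm_smul,
        specNorm_mul_diagonal_mul hUV.1 hUV.2.1]
      rw [Pi.norm_single]
      simpa using hc
    · rcases eq_or_ne j 0 with rfl | hj0
      · exact hQ0'.le
      · rw [hQ, Function.update_of_ne hj1, Function.update_of_ne hj0, sub_self, specNorm, map_zero,
          norm_zero]
        exact mul_nonneg hε.le (hw j)
  refine ⟨Q, ⟨hQball, 0, hw0, hQ0'⟩, ?_⟩
  refine two_le_algMult (detPoly_ne_zero hne hQball) hUV.1 hUV.2.1 (k := k)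
    (D := fun j => ((singVal (eval P 0) j - minSingVal (eval P 0) * 1 : ℝ) : ℂ)) ?_
    ((hb.sub_eq_zero_iff k).2 hk) ?_
  · rw [eval_zero, hQ0, ← eval_add_weightedZ hUV, eval_zero]
  · refine hc'.imp (fun ⟨j, hjk, hj⟩ => ⟨j, hjk, (hb.sub_eq_zero_iff j).2 hj⟩) fun hcc => ?_
    rw [evalDeriv_zero Q hm, hQ1, Matrix.mul_add, Matrix.add_mul, Matrix.mul_neg, Matrix.neg_mul,
      conjTranspose_mul_mul_mul hUV.1 hUV.2.1, Matrix.add_apply, ← hcc]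
    simp

end Conclusion

end MatPoly

end

theorem mainTheorem3 (n m : ℕ) (P : MatPoly.Coeffs n m) (hP : (P (Fin.last m)).det ≠ 0)
    (w : Fin (m + 1) → ℝ) (hw : ∀ j, 0 ≤ w j) (hw0 : 0 < w 0)
    (ε : ℝ) (hε : 0 < ε) (hne : MatPoly.pseudospectrum P w ε ≠ Set.univ)
    (G₁ G₂ : Set ℂ) (μ : ℂ)
    (hmeet : MatPoly.ComponentsMeetAt (MatPoly.pseudospectrum P w) ε G₁ G₂ μ) :
    -- (i)
    (μ ≠ 0 → ∀ U V : Matrix (Fin n) (Fin n) ℂ,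
      MatPoly.AreSingularVectors (MatPoly.eval P μ) U V →
        (MatPoly.Qhat P w μ U V ∈ MatPoly.pertBoundary P ε w ∧
          MatPoly.IsMultipleEigenvalue (MatPoly.Qhat P w μ U V) μ) ∧
        (MatPoly.Qtilde P w μ U V ∈ MatPoly.pertBoundary P ε w ∧
          MatPoly.IsMultipleEigenvalue (MatPoly.Qtilde P w μ U V) μ)) ∧
    -- (ii)
    (μ = 0 → MatPoly.IsConstWeight w → ∀ U V : Matrix (Fin n) (Fin n) ℂ,
      MatPoly.AreSingularVectors (MatPoly.eval P μ) U V →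
        (MatPoly.Qhat P w μ U V ∈ MatPoly.pertBoundary P ε w ∧
          MatPoly.IsMultipleEigenvalue (MatPoly.Qhat P w μ U V) μ) ∧
        (MatPoly.Qtilde P w μ U V ∈ MatPoly.pertBoundary P ε w ∧
          MatPoly.IsMultipleEigenvalue (MatPoly.Qtilde P w μ U V) μ)) ∧
    -- (iii)
    (μ = 0 → ¬ MatPoly.IsConstWeight w →
      Bornology.IsBounded (MatPoly.pseudospectrum P w ε) → G₁ ∩ G₂ = {0} →
        ∃ Q ∈ MatPoly.pertBoundary P ε w, MatPoly.IsMultipleEigenvalue Q μ) ∧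
    -- the simple case in (i) and (ii)
    ((μ ≠ 0 ∨ (μ = 0 ∧ MatPoly.IsConstWeight w)) →
      MatPoly.MinSingValSimple (MatPoly.eval P μ) → ∀ U V : Matrix (Fin n) (Fin n) ℂ,
      MatPoly.AreSingularVectors (MatPoly.eval P μ) U V →
        (MatPoly.IsDefectiveEigenvalue (MatPoly.Qhat P w μ U V) μ ∧
          MatPoly.geomMult (MatPoly.Qhat P w μ U V) μ = 1) ∧
        (MatPoly.IsDefectiveEigenvalue (MatPoly.Qtilde P w μ U V) μ ∧
          MatPoly.geomMult (MatPoly.Qtilde P w μ U V) μ = 1)) := by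
  have h := hmeet.notLocallyJoined hw hw0 hε
  have main : (μ ≠ 0 ∨ (μ = 0 ∧ MatPoly.IsConstWeight w)) → ∀ U V : Matrix (Fin n) (Fin n) ℂ,
      MatPoly.AreSingularVectors (MatPoly.eval P μ) U V →
        (MatPoly.Qhat P w μ U V ∈ MatPoly.pertBoundary P ε w ∧
          MatPoly.IsMultipleEigenvalue (MatPoly.Qhat P w μ U V) μ) ∧
        (MatPoly.Qtilde P w μ U V ∈ MatPoly.pertBoundary P ε w ∧
          MatPoly.IsMultipleEigenvalue (MatPoly.Qtilde P w μ U V) μ) := by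
    intro hμ U V hUV
    rw [MatPoly.Qhat, MatPoly.Qtilde, MatPoly.Zhat_eq, MatPoly.Ztilde_eq]
    have h1 := MatPoly.isMinWeight_one (MatPoly.eval P μ)
    have h2 := MatPoly.isMinWeight_ite (MatPoly.eval P μ)
    exact ⟨⟨MatPoly.pertAt_mem_pertBoundary hw hw0 hε h hUV h1,
      MatPoly.isMultipleEigenvalue_pertAt hw hw0 hε hne h hUV h1 hμ⟩,
      ⟨MatPoly.pertAt_mem_pertBoundary hw hw0 hε h hUV h2,
      MatPoly.isMultipleEigenvalue_pertAt hw hw0 hε hne h hUV h2 hμ⟩⟩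
  refine ⟨fun hμ => main (Or.inl hμ), fun hμ hc => main (Or.inr ⟨hμ, hc⟩), ?_, ?_⟩
  · rintro rfl hconst - -
    -- A nonconstant weight needs an index other than `0`, so a linear coefficient exists.
    have hm : 1 < m + 1 := by
      by_contra hm
      obtain rfl : m = 0 := by omega
      exact hconst fun j hj => absurd (Fin.ext (by omega)) hj
    exact MatPoly.exists_isMultipleEigenvalue_zero hw hw0 hε hne h hm
  · intro hμ hs U V hUV
    have hmult := main hμ U V hUV
    have g1 : MatPoly.geomMult (MatPoly.Qhat P w μ U V) μ = 1 := by
      rw [MatPoly.Qhat, MatPoly.Zhat_eq]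
      exact MatPoly.geomMult_pertAt hw hw0 hUV (MatPoly.isMinWeight_one _) hs
    have g2 : MatPoly.geomMult (MatPoly.Qtilde P w μ U V) μ = 1 := by
      rw [MatPoly.Qtilde, MatPoly.Ztilde_eq]
      exact MatPoly.geomMult_pertAt hw hw0 hUV (MatPoly.isMinWeight_ite _) hs
    exact ⟨⟨⟨hmult.1.2, g1.trans_lt hmult.1.2⟩, g1⟩, ⟨⟨hmult.2.2, g2.trans_lt hmult.2.2⟩, g2⟩⟩
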